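/- **Polymorphisms.** Let $\mathbb R^\circ$ be the multiplicative group of positive reals with coordinate $t$. For probability Lebesgue spaces $(M,\mu)$, $(N,\nu)$ (atoms allowed), a polymorphism $\mathfrak p:M\rightrightarrows N$ is a measure on $M\times N\times\mathbb R^\circ$ whose projection to $M$ is $\mu$ and such that the projection of $t\cdot\mathfrak p$ to $N$ is $\nu$; $\mathrm{Pol}(M,N)$ is the set of polymorphisms. Let $\kappa^{\mathfrak p}_m$, $m\in M$, be the conditional measures of $\mathfrak p$ on the fibres $\{m\}\times N\times \mathbb R^\circ$. The product $\mathfrak p\,\mathfrak q\in \mathrm{Pol}(M,K)$ of $\mathfrak p\in\mathrm{Pol}(M,N)$ and $\mathfrak q\in\mathrm{Pol}(N,K)$ (first $\mathfrak p$, then $\mathfrak q$) is the polymorphism whose conditional measure at $m$ is the image of $\kappa^{\mathfrak p}_m(dn,dt)\,\kappa^{\mathfrak q}_n(dk,ds)$ under $(n,t,k,s)\mapsto(k,ts)$. With this product, probability Lebesgue spaces and polymorphisms form a category $\mathrm{Pol}$; the identity of $M$ is the image of $\mu$ under $m\mapsto(m,m,1)$. The involution $\mathfrak p\mapsto\mathfrak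 p^\star\in\mathrm{Pol}(N,M)$ sends $\mathfrak p$ to the image of $t\cdot\mathfrak p$ under $(m,n,t)\mapsto(n,m,t^{-1})$. For measurable $A\subset M$, $B\subset N$ let $\mathfrak p[A\times B]$ be the image on $\mathbb R^\circ$ of the restriction of $\mathfrak p$ to $A\times B\times\mathbb R^\circ$; $\mathrm{Pol}(M,N)$ carries the topology in which $\mathfrak p_j\to\mathfrak p$ iff $\mathfrak p_j[A\times B]\to\mathfrak p[A\times B]$ and $t\cdot\mathfrak p_j[A\times B]\to t\cdot\mathfrak p[A\times B]$ weakly for all $A,B$. A transformation $m\mapsto mg$ of $M$ leaving $\mu$ quasi-invariant, with Radon–Nikodym derivative $g'$ (that is, $\mu(Bg)=\int_B g'\,d\mu$), is regarded as the element of $\mathrm{Pol}(M,M)$ that is the image of $\mu$ under $m\mapsto(m,mg,g'(m))$. **$(G,K)$-pairs and trains.** Unitary representations are strongly continuous and act in separable complex Hilbert spaces. For a unitary representation $\rho$ of a topological group $G$ in $H$ and a subgroup $L\subset G$ let $H(L)$ be the space of $L$-fixed vectors and $P(L)$ the orthogonal projection to it; for subgroups $L,L'$ and $g\in G$ put $\tilde\rho_{L,L'}(g)=P(L)\rho(g)|_{H(L')}:H(L')\to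 H(L)$. A $(G,K)$-pair consists of a separable topological group $G$, a subgroup $K$, a partially ordered set $\mathcal A$ in which every two elements have a common upper bound, and subgroups $K_\alpha\subset K$, $\alpha\in\mathcal A$, with $K_\alpha\subset K_{\alpha'}$ whenever $\alpha\succcurlyeq\alpha'$, such that (A) for all $\alpha,\beta,\gamma\in\mathcal A$ and $g,h\in G$ there is $p\in G$ with $\tilde\rho_{K_\alpha,K_\beta}(g)\,\tilde\rho_{K_\beta,K_\gamma}(h)=\tilde\rho_{K_\alpha,K_\gamma}(p)$ for every unitary representation $\rho$ of $G$; (B) for every unitary representation, $\bigcup_{\alpha}H(K_\alpha)$ is dense in $H$. Let $[K_\alpha\backslash G/K_\beta]$ be the quotient of $G$ by the equivalence relation: $g\sim g'$ iff $\tilde\rho_{K_\alpha,K_\beta}(g)=\tilde\rho_{K_\alpha,K_\beta}(g')$ for all unitary representations $\rho$. In (A) the class of $p$ depends only on the classes of $g$ and $h$; denote it by $[g]\circ[h]$. The train $\mathcal T(G,K)$ is the category with the set of objects $\mathcal A$, morphisms $\beta\to\alpha$ being the elements of $[K_\alpha\backslash G/K_\beta]$, and composition $\circ$. **Actions.** Let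 $(M,\mu)$ be a probability Lebesgue space. An action of the $(G,K)$-pair on $M$ is an action $m\mapsto mg$ of $G$ by transformations (considered up to null sets) leaving $\mu$ quasi-invariant, such that the map $G\to\mathrm{Pol}(M,M)$ is continuous and $K$ preserves $\mu$. Let $\Sigma[\alpha]$ be the σ-algebra of measurable sets $B\subset M$ such that $\mu(B\,\triangle\,Bg)=0$ for all $g\in K_\alpha$. A quotient of $M$ by $\Sigma[\alpha]$ is a probability Lebesgue space $M[\alpha]$ with a measure preserving map $\pi_\alpha:M\to M[\alpha]$ such that $\Sigma[\alpha]$ consists precisely of the measurable sets that coincide up to null sets with preimages $\pi_\alpha^{-1}(C)$ of measurable sets $C$. The canonical polymorphism $\mathfrak x[\alpha]\in\mathrm{Pol}(M,M[\alpha])$ is the image of $\mu$ under $m\mapsto(m,\pi_\alpha(m),1)$. **Theorem.** Let a $(G,K)$-pair act on a probability Lebesgue space $M$. Then a quotient $M[\alpha]$ exists for each $\alpha\in\mathcal A$, and for any choice of the quotients the polymorphisms $$\Xi_{\alpha,\beta}(g)=\mathfrak x[\alpha]^\star\, g\,\mathfrak x[\beta]\in\mathrm{Pol}(M[\alpha],M[\beta])$$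 (products written from left to right) determine a functor from the train $\mathcal T(G,K)$ to the category of polymorphisms: there is a functor $\mathcal T(G,K)^{\mathrm{op}}\to\mathrm{Pol}$ which sends each $\alpha$ to $M[\alpha]$ and the morphism $[K_\alpha gK_\beta]:\beta\to\alpha$ to $\Xi_{\alpha,\beta}(g):M[\alpha]\rightrightarrows M[\beta]$, for all $\alpha,\beta\in\mathcal A$, $g\in G$. In particular, $\Xi_{\alpha,\beta}(g)$ depends only on the class of $g$ in $[K_\alpha\backslash G/K_\beta]$, $\Xi_{\alpha,\alpha}(1)$ is the identity, and $\Xi_{\alpha,\beta}(g)\,\Xi_{\beta,\gamma}(h)=\Xi_{\alpha,\gamma}(p)$ whenever $[g]\circ[h]=[p]$. -/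

import Mathlib

open MeasureTheory ProbabilityTheory CategoryTheory TopologicalSpace
open scoped ENNReal

universe u v w x

noncomputable section

/-! ### The multiplicative group of positive reals -/

/-- The multiplicative group of positive real numbers. -/
abbrev PosReal : Type := {t : ℝ // 0 < t}

instance PosReal.instStandardBorelSpace : StandardBorelSpace PosReal :=
  (measurableSet_Ioi (a := (0 : ℝ))).standardBorel

instance PosReal.instMeasurableMul₂ : MeasurableMul₂ PosReal where
  measurable_mul := by
    apply Measurable.subtype_mk
    exact (measurable_subtype_coe.comp measurable_fst).mul
      (measurable_subtype_coe.comp measurable_snd)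

instance PosReal.instMeasurableInv : MeasurableInv PosReal where
  measurable_inv := by
    apply Measurable.subtype_mk
    exact measurable_subtype_coe.inv

/-- A positive real number as an extended nonnegative number. -/
def PosReal.toENNReal (t : PosReal) : ℝ≥0∞ := ENNReal.ofReal t

@[fun_prop] lemma PosReal.measurable_toENNReal : Measurable PosReal.toENNReal :=
  measurable_subtype_coe.ennreal_ofReal

lemma PosReal.toENNReal_one : PosReal.toENNReal 1 = 1 := by
  simp [PosReal.toENNReal]

lemma PosReal.toENNReal_mul (s t : PosReal) :
    (s * t).toENNReal = s.toENNReal * t.toENNReal := by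
  simp [PosReal.toENNReal, ENNReal.ofReal_mul s.2.le]

lemma PosReal.toENNReal_ne_zero (t : PosReal) : t.toENNReal ≠ 0 := by
  simpa [PosReal.toENNReal] using t.2

lemma PosReal.toENNReal_inv_mul (t : PosReal) : t⁻¹.toENNReal * t.toENNReal = 1 := by
  rw [← PosReal.toENNReal_mul, inv_mul_cancel, PosReal.toENNReal_one]

lemma PosReal.toENNReal_mul_inv (t : PosReal) : t.toENNReal * t⁻¹.toENNReal = 1 := by
  rw [← PosReal.toENNReal_mul, mul_inv_cancel, PosReal.toENNReal_one]

/-! ### Lebesgue probability spaces -/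

/-- A probability Lebesgue space: a standard Borel space with a probability measure (atoms are
allowed). -/
structure LebesgueSpace : Type (u + 1) where
  carrier : Type u
  [measurableSpace : MeasurableSpace carrier]
  [standardBorel : StandardBorelSpace carrier]
  measure : Measure carrier
  [isProbability : IsProbabilityMeasure measure]

instance LebesgueSpace.instCoeSort : CoeSort LebesgueSpace.{u} (Type u) :=
  ⟨LebesgueSpace.carrier⟩

attribute [instance] LebesgueSpace.measurableSpace LebesgueSpace.standardBorel
  LebesgueSpace.isProbability

instance LebesgueSpace.instNonempty (M : LebesgueSpace.{u}) : Nonempty M :=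
  M.measure.nonempty_of_neZero

/-! ### Polymorphisms -/

/-- A polymorphism from `M` to `N`: a measure on `M × N × ℝ_{>0}` whose projection to `M` is the
measure of `M`, and such that the projection to `N` of its product with the coordinate `t` is the
measure of `N`. -/
@[ext] structure Polymorphism (M N : LebesgueSpace.{u}) : Type u where
  toMeasure : Measure (M × N × PosReal)
  map_fst : toMeasure.map (fun z => z.1) = M.measure
  map_snd : (toMeasure.withDensity (fun z => z.2.2.toENNReal)).map (fun z => z.2.1) = N.measure

namespace Polymorphism

variable {M N K L : LebesgueSpace.{u}}

instance instIsProbabilityMeasure (p : Polymorphism M N) :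
    IsProbabilityMeasure p.toMeasure := by
  have h : IsProbabilityMeasure (p.toMeasure.map (fun z => z.1)) := by
    rw [p.map_fst]; infer_instance
  exact Measure.isProbabilityMeasure_of_map (fun z : M × N × PosReal => z.1)

lemma lintegral_fst (p : Polymorphism M N) {f : M → ℝ≥0∞} (hf : Measurable f) :
    ∫⁻ z, f z.1 ∂p.toMeasure = ∫⁻ m, f m ∂M.measure := by
  rw [← p.map_fst, lintegral_map hf (by fun_prop)]

lemma lintegral_snd (p : Polymorphism M N) {f : N → ℝ≥0∞} (hf : Measurable f) :
    ∫⁻ z, z.2.2.toENNReal * f z.2.1 ∂p.toMeasure = ∫⁻ n, f n ∂N.measure := by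
  rw [← p.map_snd, lintegral_map hf (by fun_prop),
    lintegral_withDensity_eq_lintegral_mul _ (by fun_prop) (by fun_prop)]
  rfl

/-- Constructor: it suffices to check the two marginal conditions on integrals. -/
lemma map_fst_of_lintegral {μ : Measure (M × N × PosReal)}
    (h : ∀ f : M → ℝ≥0∞, Measurable f → ∫⁻ z, f z.1 ∂μ = ∫⁻ m, f m ∂M.measure) :
    μ.map (fun z => z.1) = M.measure := by
  refine Measure.ext_of_lintegral _ fun f hf => ?_
  rw [lintegral_map hf (by fun_prop), h f hf]

lemma map_snd_of_lintegral {μ : Measure (M × N × PosReal)}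
    (h : ∀ f : N → ℝ≥0∞, Measurable f →
      ∫⁻ z, z.2.2.toENNReal * f z.2.1 ∂μ = ∫⁻ n, f n ∂N.measure) :
    (μ.withDensity (fun z => z.2.2.toENNReal)).map (fun z => z.2.1) = N.measure := by
  refine Measure.ext_of_lintegral _ fun f hf => ?_
  rw [lintegral_map hf (by fun_prop),
    lintegral_withDensity_eq_lintegral_mul _ (by fun_prop) (by fun_prop), ← h f hf]
  rfl

/-- Two polymorphisms with the same integrals coincide. -/
lemma ext_lintegral {p q : Polymorphism M N}
    (h : ∀ f : M × N × PosReal → ℝ≥0∞, Measurable f →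
      ∫⁻ z, f z ∂p.toMeasure = ∫⁻ z, f z ∂q.toMeasure) : p = q :=
  Polymorphism.ext (Measure.ext_of_lintegral _ h)

/-- The measure preserving polymorphism of a measure preserving map `π : M → N`: the image of the
measure of `M` under `m ↦ (m, π m, 1)`. -/
def ofMap (π : M → N) (h : MeasurePreserving π M.measure N.measure) : Polymorphism M N where
  toMeasure := M.measure.map (fun m => (m, π m, 1))
  map_fst := by
    have hm := h.measurable
    refine map_fst_of_lintegral fun f hf => ?_
    rw [lintegral_map (by fun_prop) (by fun_prop)]
  map_snd := by
    have hm := h.measurable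
    refine map_snd_of_lintegral fun f hf => ?_
    rw [lintegral_map (by fun_prop) (by fun_prop)]
    simp only [PosReal.toENNReal_one, one_mul]
    rw [h.lintegral_comp hf]

/-- The identical polymorphism. -/
def id (M : LebesgueSpace.{u}) : Polymorphism M M := ofMap _root_.id (MeasurePreserving.id _)

/-- The involution: the image of the measure `t • p` under `(m, n, t) ↦ (n, m, t⁻¹)`, where `t`
denotes the coordinate on the source. -/
def star (p : Polymorphism M N) : Polymorphism N M where
  toMeasure := (p.toMeasure.withDensity (fun z => z.2.2.toENNReal)).map
    (fun z => (z.2.1, z.1, z.2.2⁻¹))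
  map_fst := by
    refine map_fst_of_lintegral fun f hf => ?_
    rw [lintegral_map (by fun_prop) (by fun_prop),
      lintegral_withDensity_eq_lintegral_mul _ (by fun_prop) (by fun_prop), ← p.lintegral_snd hf]
    rfl
  map_snd := by
    refine map_snd_of_lintegral fun f hf => ?_
    rw [lintegral_map (by fun_prop) (by fun_prop),
      lintegral_withDensity_eq_lintegral_mul _ (by fun_prop) (by fun_prop), ← p.lintegral_fst hf]
    refine lintegral_congr fun z => ?_
    simp only [Pi.mul_apply]
    rw [← mul_assoc, PosReal.toENNReal_mul_inv, one_mul]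

/-- The spreading map of a polymorphism: the system of conditional measures on the fibres
`{m} × N × ℝ_{>0}`, `m ∈ M`. -/
def spread (p : Polymorphism M N) : Kernel M (N × PosReal) := p.toMeasure.condKernel

instance instIsMarkovKernelSpread (p : Polymorphism M N) : IsMarkovKernel p.spread := by
  unfold spread; infer_instance

/-- `p` disintegrates as `∫ δ_m ⊗ κ_m dμ(m)`. -/
lemma compProd_spread (p : Polymorphism M N) : M.measure ⊗ₘ p.spread = p.toMeasure := by
  have h := p.toMeasure.disintegrate p.toMeasure.condKernel
  have h1 : p.toMeasure.fst = M.measure := p.map_fst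
  rw [h1] at h
  exact h

lemma spread_ae_eq (p : Polymorphism M N) (κ : Kernel M (N × PosReal)) [IsFiniteKernel κ]
    (h : p.toMeasure = M.measure ⊗ₘ κ) : ∀ᵐ m ∂M.measure, p.spread m = κ m := by
  have h1 : p.toMeasure.fst = M.measure := p.map_fst
  have := eq_condKernel_of_measure_eq_compProd (ρ := p.toMeasure) κ (by rw [h1]; exact h)
  rw [h1] at this
  filter_upwards [this] with m hm
  exact hm.symm

lemma lintegral_eq_spread (p : Polymorphism M N) {f : M × N × PosReal → ℝ≥0∞}
    (hf : Measurable f) :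
    ∫⁻ z, f z ∂p.toMeasure = ∫⁻ m, ∫⁻ y, f (m, y) ∂p.spread m ∂M.measure := by
  rw [← p.compProd_spread, Measure.lintegral_compProd hf]

lemma measurable_lintegral_spread (q : Polymorphism N K) {X : Type*} [MeasurableSpace X]
    {g : X → N} (hg : Measurable g) {f : X → K × PosReal → ℝ≥0∞}
    (hf : Measurable (Function.uncurry f)) :
    Measurable fun x => ∫⁻ y, f x y ∂q.spread (g x) :=
  Measurable.lintegral_kernel_prod_right (κ := q.spread.comap g hg) hf

/-- A property that holds almost everywhere on `N` holds for almost all `(m, n, t)`. -/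
lemma ae_snd (p : Polymorphism M N) {P : N → Prop} (h : ∀ᵐ n ∂N.measure, P n) :
    ∀ᵐ z ∂p.toMeasure, P z.2.1 := by
  rw [← p.map_snd] at h
  have h1 := ae_of_ae_map (by fun_prop) h
  exact (withDensity_absolutelyContinuous' (by fun_prop)
    (Filter.Eventually.of_forall fun z => z.2.2.toENNReal_ne_zero)).ae_le h1

/-- The product measure: a point `m` is spread first by `p` to `(n, t)`, then `n` is spread by `q`
to `(k, s)`; the second coordinates are multiplied. If `p` and `q` are given by functions
`u_{m,n}`, `v_{n,k}` with values in measures on `ℝ_{>0}`, then the product is given by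
`∫ u_{m,n} * v_{n,k} dν(n)`, where `*` is the multiplicative convolution. -/
def compMeasure (p : Polymorphism M N) (q : Polymorphism N K) : Measure (M × K × PosReal) :=
  (p.toMeasure ⊗ₘ q.spread.comap (fun z : M × N × PosReal => z.2.1) (by fun_prop)).map
    (fun y => (y.1.1, y.2.1, y.1.2.2 * y.2.2))

lemma lintegral_compMeasure (p : Polymorphism M N) (q : Polymorphism N K)
    {f : M × K × PosReal → ℝ≥0∞} (hf : Measurable f) :
    ∫⁻ z, f z ∂compMeasure p q =
      ∫⁻ z, ∫⁻ y, f (z.1, y.1, z.2.2 * y.2) ∂q.spread z.2.1 ∂p.toMeasure := by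
  rw [compMeasure, lintegral_map hf (by fun_prop), Measure.lintegral_compProd (by fun_prop)]
  rfl

/-- The product of polymorphisms, written from left to right: first `p`, then `q`. -/
def comp (p : Polymorphism M N) (q : Polymorphism N K) : Polymorphism M K where
  toMeasure := compMeasure p q
  map_fst := by
    refine map_fst_of_lintegral fun f hf => ?_
    rw [lintegral_compMeasure p q (by fun_prop), ← p.lintegral_fst hf]
    simp
  map_snd := by
    refine map_snd_of_lintegral fun f hf => ?_
    have hg : Measurable fun n => ∫⁻ y, y.2.toENNReal * f y.1 ∂q.spread n :=
      Measurable.lintegral_kernel (by fun_prop)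
    rw [lintegral_compMeasure p q (by fun_prop), ← q.lintegral_snd hf,
      q.lintegral_eq_spread (by fun_prop), ← p.lintegral_snd hg]
    refine lintegral_congr fun z => ?_
    rw [← lintegral_const_mul _ (by fun_prop)]
    refine lintegral_congr fun y => ?_
    rw [PosReal.toENNReal_mul, mul_assoc]

lemma lintegral_comp (p : Polymorphism M N) (q : Polymorphism N K)
    {f : M × K × PosReal → ℝ≥0∞} (hf : Measurable f) :
    ∫⁻ z, f z ∂(comp p q).toMeasure =
      ∫⁻ z, ∫⁻ y, f (z.1, y.1, z.2.2 * y.2) ∂q.spread z.2.1 ∂p.toMeasure :=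
  lintegral_compMeasure p q hf

/-- The spreading map of a product. -/
def spreadComp (p : Polymorphism M N) (q : Polymorphism N K) : Kernel M (K × PosReal) :=
  (p.spread.compProd (q.spread.comap (fun z : M × N × PosReal => z.2.1) (by fun_prop))).map
    (fun y => (y.2.1, y.1.2 * y.2.2))

instance instIsMarkovKernelSpreadComp (p : Polymorphism M N) (q : Polymorphism N K) :
    IsMarkovKernel (spreadComp p q) := by
  unfold spreadComp
  exact Kernel.IsMarkovKernel.map _ (by fun_prop)

lemma lintegral_spreadComp (p : Polymorphism M N) (q : Polymorphism N K)
    {f : K × PosReal → ℝ≥0∞} (hf : Measurable f) (m : M) :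
    ∫⁻ z, f z ∂spreadComp p q m =
      ∫⁻ z, ∫⁻ y, f (y.1, z.2 * y.2) ∂q.spread z.1 ∂p.spread m := by
  rw [spreadComp, Kernel.map_apply _ (by fun_prop), lintegral_map hf (by fun_prop),
    Kernel.lintegral_compProd _ _ _ (by fun_prop)]
  rfl

lemma spread_comp (p : Polymorphism M N) (q : Polymorphism N K) :
    ∀ᵐ m ∂M.measure, (comp p q).spread m = spreadComp p q m := by
  refine spread_ae_eq _ _ (Measure.ext_of_lintegral _ fun f hf => ?_)
  rw [lintegral_comp p q hf, Measure.lintegral_compProd hf, p.lintegral_eq_spread]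
  · refine lintegral_congr fun m => ?_
    rw [lintegral_spreadComp p q (by fun_prop)]
  · exact q.measurable_lintegral_spread (by fun_prop) (by fun_prop)

lemma comp_assoc (p : Polymorphism M N) (q : Polymorphism N K) (r : Polymorphism K L) :
    comp (comp p q) r = comp p (comp q r) := by
  refine ext_lintegral fun f hf => ?_
  rw [lintegral_comp _ r hf, lintegral_comp p _ hf, lintegral_comp p q]
  · refine lintegral_congr_ae ?_
    filter_upwards [p.ae_snd (spread_comp q r)] with z hz
    rw [hz, lintegral_spreadComp q r (by fun_prop)]
    simp only [mul_assoc]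
  · exact r.measurable_lintegral_spread (by fun_prop) (by fun_prop)

lemma lintegral_id {f : M × M × PosReal → ℝ≥0∞} (hf : Measurable f) :
    ∫⁻ z, f z ∂(id M).toMeasure = ∫⁻ m, f (m, m, 1) ∂M.measure := by
  change ∫⁻ z, f z ∂(M.measure.map (fun m => (m, _root_.id m, (1 : PosReal)))) = _
  rw [lintegral_map hf (by fun_prop)]
  rfl

lemma spread_id : ∀ᵐ m ∂M.measure,
    (id M).spread m = Kernel.deterministic (fun m : M => (m, (1 : PosReal))) (by fun_prop) m := by
  refine spread_ae_eq _ _ (Measure.ext_of_lintegral _ fun f hf => ?_)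
  rw [lintegral_id hf, Measure.lintegral_compProd hf]
  refine lintegral_congr fun m => ?_
  rw [Kernel.lintegral_deterministic' _ (by fun_prop)]

lemma id_comp (p : Polymorphism M N) : comp (id M) p = p := by
  refine ext_lintegral fun f hf => ?_
  rw [lintegral_comp _ _ hf, lintegral_id, p.lintegral_eq_spread hf]
  · simp
  · exact p.measurable_lintegral_spread (by fun_prop) (by fun_prop)

lemma comp_id (p : Polymorphism M N) : comp p (id N) = p := by
  refine ext_lintegral fun f hf => ?_
  rw [lintegral_comp _ _ hf]
  refine lintegral_congr_ae ?_
  filter_upwards [p.ae_snd spread_id] with z hz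
  rw [hz, Kernel.lintegral_deterministic' _ (by fun_prop)]
  simp

/-- For measurable `A ⊆ M`, `B ⊆ N`, the image on `ℝ_{>0}` of the restriction of `p` to
`A × B × ℝ_{>0}`. -/
def block (p : Polymorphism M N) (A : Set M) (B : Set N) : FiniteMeasure PosReal :=
  ⟨(p.toMeasure.restrict (A ×ˢ B ×ˢ Set.univ)).map (fun z => z.2.2), inferInstance⟩

/-- The product of `p.block A B` with the coordinate `t`. -/
def tBlock (p : Polymorphism M N) (A : Set M) (B : Set N) : FiniteMeasure PosReal :=
  ⟨(p.block A B : Measure PosReal).withDensity PosReal.toENNReal, by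
    refine isFiniteMeasure_withDensity (ne_of_lt ?_)
    have h := p.lintegral_snd (f := fun _ => 1) measurable_const
    change ∫⁻ t, PosReal.toENNReal t ∂((p.toMeasure.restrict (A ×ˢ B ×ˢ Set.univ)).map _) < ⊤
    rw [lintegral_map (by fun_prop) (by fun_prop)]
    refine lt_of_le_of_lt (setLIntegral_le_lintegral _ _) ?_
    simp only [mul_one, lintegral_const, measure_univ] at h
    rw [h]
    exact ENNReal.one_lt_top⟩

/-- The topology of convergence of polymorphisms: `p_j → p` if for all measurable `A ⊆ M`,
`B ⊆ N` the finite measures `p_j[A × B]` and `t • p_j[A × B]` on `ℝ_{>0}` converge weakly to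
`p[A × B]` and `t • p[A × B]`. -/
instance instTopologicalSpace : TopologicalSpace (Polymorphism M N) :=
  (⨅ (A : Set M) (_ : MeasurableSet A) (B : Set N) (_ : MeasurableSet B),
    induced (fun p => p.block A B) inferInstance) ⊓
  (⨅ (A : Set M) (_ : MeasurableSet A) (B : Set N) (_ : MeasurableSet B),
    induced (fun p => p.tBlock A B) inferInstance)

end Polymorphism

/-- The category of polymorphisms: objects are probability Lebesgue spaces, morphisms from `M` to
`N` are polymorphisms from `M` to `N`. -/
instance LebesgueSpace.instCategory : Category.{u, u + 1} LebesgueSpace.{u} where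
  Hom M N := Polymorphism M N
  id M := Polymorphism.id M
  comp p q := Polymorphism.comp p q
  id_comp := Polymorphism.id_comp
  comp_id := Polymorphism.comp_id
  assoc := Polymorphism.comp_assoc

/-! ### Unitary representations and trains -/

/-- A (strongly continuous) unitary representation of a topological group. -/
structure UnitaryRep (G : Type v) [Group G] [TopologicalSpace G]
    (H : Type w) [NormedAddCommGroup H] [InnerProductSpace ℂ H] [CompleteSpace H] where
  toHom : G →* unitary (H →L[ℂ] H)
  continuous_apply : ∀ ξ : H, Continuous fun g : G => (toHom g : H →L[ℂ] H) ξ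

namespace UnitaryRep

variable {G : Type v} [Group G] [TopologicalSpace G]
  {H : Type w} [NormedAddCommGroup H] [InnerProductSpace ℂ H] [CompleteSpace H]

/-- The subspace of vectors fixed by the subgroup `K`. -/
def fixed (ρ : UnitaryRep G H) (K : Subgroup G) : Submodule ℂ H where
  carrier := {ξ | ∀ k ∈ K, (ρ.toHom k : H →L[ℂ] H) ξ = ξ}
  add_mem' ha hb k hk := by rw [map_add, ha k hk, hb k hk]
  zero_mem' k _ := map_zero _
  smul_mem' c ξ hξ k hk := by rw [map_smul, hξ k hk]

lemma isClosed_fixed (ρ : UnitaryRep G H) (K : Subgroup G) : IsClosed (ρ.fixed K : Set H) := by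
  have : (ρ.fixed K : Set H) = ⋂ k ∈ K, {ξ | (ρ.toHom k : H →L[ℂ] H) ξ = ξ} := by
    ext ξ; simp [fixed]
  rw [this]
  exact isClosed_biInter fun k _ =>
    isClosed_eq (ρ.toHom k : H →L[ℂ] H).continuous continuous_id

instance instCompleteSpaceFixed (ρ : UnitaryRep G H) (K : Subgroup G) :
    CompleteSpace (ρ.fixed K) := (ρ.isClosed_fixed K).completeSpace_coe

/-- The operator `P(K) ρ(g)` from the `L`-fixed vectors to the `K`-fixed vectors, where `P(K)` is
the orthogonal projection. -/
def compress (ρ : UnitaryRep G H) (K L : Subgroup G) (g : G) : ρ.fixed L →L[ℂ] ρ.fixed K :=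
  (ρ.fixed K).orthogonalProjectionOnto ∘L (ρ.toHom g : H →L[ℂ] H) ∘L (ρ.fixed L).subtypeL

lemma compress_one (ρ : UnitaryRep G H) (K : Subgroup G) :
    ρ.compress K K 1 = ContinuousLinearMap.id ℂ (ρ.fixed K) := by
  ext ξ
  simp [compress]

end UnitaryRep

/-- The coarse equivalence of double cosets: `g ∼ g'` if `P(K) ρ(g) = P(K) ρ(g')` on the
`L`-fixed vectors, for all unitary representations `ρ` in separable Hilbert spaces. -/
def coarseSetoid {G : Type v} [Group G] [TopologicalSpace G] (K L : Subgroup G) : Setoid G where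
  r g g' := ∀ (H : Type w) [NormedAddCommGroup H] [InnerProductSpace ℂ H] [CompleteSpace H]
    [SeparableSpace H] (ρ : UnitaryRep G H), ρ.compress K L g = ρ.compress K L g'
  iseqv :=
    { refl := by intros; rfl
      symm := by intro a b h H _ _ _ _ ρ; exact (h H ρ).symm
      trans := by intro a b c h h' H _ _ _ _ ρ; exact (h H ρ).trans (h' H ρ) }

/-- A `(G, K)`-pair, `A` being the index set: a subgroup `K` of `G` with a family of subgroups `K_α ⊆ K`, indexed by a
directed partially ordered set and decreasing in `α`, subject to conditions A (`mul`) and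
B (`dense`). -/
structure GKPair (G : Type v) [Group G] [TopologicalSpace G] (A : Type x) [PartialOrder A] where
  K : Subgroup G
  sub : A → Subgroup G
  sub_le : ∀ α, sub α ≤ K
  directed : ∀ α α' : A, ∃ ν, α ≤ ν ∧ α' ≤ ν
  antitone : ∀ α α' : A, α' ≤ α → sub α ≤ sub α'
  mul : ∀ (α β γ : A) (g h : G), ∃ p : G,
    ∀ (H : Type w) [NormedAddCommGroup H] [InnerProductSpace ℂ H] [CompleteSpace H]
      [SeparableSpace H] (ρ : UnitaryRep G H),
      ρ.compress (sub α) (sub β) g ∘L ρ.compress (sub β) (sub γ) h =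
        ρ.compress (sub α) (sub γ) p
  dense : ∀ (H : Type w) [NormedAddCommGroup H] [InnerProductSpace ℂ H] [CompleteSpace H]
    [SeparableSpace H] (ρ : UnitaryRep G H), Dense (⋃ α, (ρ.fixed (sub α) : Set H))

section Train

variable {G : Type v} [Group G] [TopologicalSpace G] {A : Type x} [PartialOrder A]

namespace GKPair

/-- The set of reduced double cosets `[K_α \ G / K_β]`. -/
def Coset (P : GKPair.{v, w, x} G A) (α β : A) : Type v :=
  Quotient (coarseSetoid.{v, w} (P.sub α) (P.sub β))

/-- The class `[K_α g K_β]`. -/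
def coset (P : GKPair.{v, w, x} G A) (α β : A) (g : G) : P.Coset α β :=
  Quotient.mk (coarseSetoid.{v, w} (P.sub α) (P.sub β)) g

variable (P : GKPair.{v, w, x} G A)

lemma coset_eq_iff {α β : A} {g g' : G} : P.coset α β g = P.coset α β g' ↔
    ∀ (H : Type w) [NormedAddCommGroup H] [InnerProductSpace ℂ H] [CompleteSpace H]
      [SeparableSpace H] (ρ : UnitaryRep G H),
      ρ.compress (P.sub α) (P.sub β) g = ρ.compress (P.sub α) (P.sub β) g' :=
  ⟨fun h => Quotient.exact h, fun h => Quotient.sound h⟩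

/-- The product `[K_α \ G / K_β] × [K_β \ G / K_γ] → [K_α \ G / K_γ]` of reduced double cosets,
see `coset_mul_eq_iff`. -/
def cosetMul {α β γ : A} (a : P.Coset α β) (b : P.Coset β γ) : P.Coset α γ :=
  P.coset α γ (Classical.choose (P.mul α β γ (Quotient.out a) (Quotient.out b)))

/-- `[K_α g K_β] ∘ [K_β h K_γ] = [K_α p K_γ]` if and only if the corresponding operators multiply
in all unitary representations. -/
lemma coset_mul_eq_iff {α β γ : A} (g h p : G) :
    P.cosetMul (P.coset α β g) (P.coset β γ h) = P.coset α γ p ↔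
    ∀ (H : Type w) [NormedAddCommGroup H] [InnerProductSpace ℂ H] [CompleteSpace H]
      [SeparableSpace H] (ρ : UnitaryRep G H),
      ρ.compress (P.sub α) (P.sub β) g ∘L ρ.compress (P.sub β) (P.sub γ) h =
        ρ.compress (P.sub α) (P.sub γ) p := by
  have hg : P.coset α β (Quotient.out (P.coset α β g)) = P.coset α β g := Quotient.out_eq _
  have hh : P.coset β γ (Quotient.out (P.coset β γ h)) = P.coset β γ h := Quotient.out_eq _
  rw [coset_eq_iff] at hg hh
  have hc := Classical.choose_spec
    (P.mul α β γ (Quotient.out (P.coset α β g)) (Quotient.out (P.coset β γ h)))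
  rw [cosetMul, coset_eq_iff]
  constructor
  · intro H1 H _ _ _ _ ρ
    rw [← H1 H ρ, ← hc H ρ, hg H ρ, hh H ρ]
  · intro H1 H _ _ _ _ ρ
    rw [← H1 H ρ, ← hc H ρ, hg H ρ, hh H ρ]

lemma exists_coset {α β : A} (a : P.Coset α β) : ∃ g, a = P.coset α β g :=
  ⟨Quotient.out a, (Quotient.out_eq a).symm⟩

lemma cosetMul_assoc {α β γ δ : A} (a : P.Coset α β) (b : P.Coset β γ) (c : P.Coset γ δ) :
    P.cosetMul (P.cosetMul a b) c = P.cosetMul a (P.cosetMul b c) := by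
  obtain ⟨g, rfl⟩ := P.exists_coset a
  obtain ⟨h, rfl⟩ := P.exists_coset b
  obtain ⟨k, rfl⟩ := P.exists_coset c
  obtain ⟨gh, h1⟩ := P.exists_coset (P.cosetMul (P.coset α β g) (P.coset β γ h))
  obtain ⟨hk, h2⟩ := P.exists_coset (P.cosetMul (P.coset β γ h) (P.coset γ δ k))
  obtain ⟨q, h3⟩ := P.exists_coset (P.cosetMul (P.coset α β g) (P.coset β δ hk))
  rw [h1, h2, h3]
  rw [coset_mul_eq_iff] at h1 h2 h3 ⊢
  intro H _ _ _ _ ρ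
  rw [← h1 H ρ, ← h3 H ρ, ← h2 H ρ]
  rfl

lemma coset_one_mul {α β : A} (a : P.Coset α β) : P.cosetMul (P.coset α α 1) a = a := by
  obtain ⟨g, rfl⟩ := P.exists_coset a
  rw [coset_mul_eq_iff]
  intro H _ _ _ _ ρ
  rw [ρ.compress_one]
  rfl

lemma coset_mul_one {α β : A} (a : P.Coset α β) : P.cosetMul a (P.coset β β 1) = a := by
  obtain ⟨g, rfl⟩ := P.exists_coset a
  rw [coset_mul_eq_iff]
  intro H _ _ _ _ ρ
  rw [ρ.compress_one]
  rfl

end GKPair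

/-- The objects of the train of a `(G, K)`-pair: the elements of the index set. -/
@[ext] structure Train (P : GKPair.{v, w, x} G A) : Type x where
  index : A

/-- The train category: morphisms `β ⟶ α` are the reduced double cosets `[K_α \ G / K_β]`; the
composition of `h : γ ⟶ β` with `g : β ⟶ α` is the product `g ∘ h`. -/
instance Train.instCategory (P : GKPair.{v, w, x} G A) : Category.{v, x} (Train P) where
  Hom b a := P.Coset a.index b.index
  id a := P.coset a.index a.index 1
  comp h g := P.cosetMul g h
  id_comp g := P.coset_mul_one g
  comp_id g := P.coset_one_mul g
  assoc h g f := (P.cosetMul_assoc f g h).symm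

/-- The morphism `[K_α g K_β] : β ⟶ α` of the train. -/
def Train.mor (P : GKPair.{v, w, x} G A) (α β : A) (g : G) : (⟨β⟩ : Train P) ⟶ ⟨α⟩ :=
  P.coset α β g

end Train

/-! ### Actions -/

/-- A right action `m ↦ m g` of `G` on `M` by transformations leaving the measure quasi-invariant,
i.e. a homomorphism from `G` to the group of such transformations (identified if they coincide
almost everywhere). -/
structure QuasiAction (G : Type v) [Group G] (M : LebesgueSpace.{u}) where
  act : G → M → M
  quasi : ∀ g, Measure.QuasiMeasurePreserving (act g) M.measure M.measure
  act_one : act 1 =ᵐ[M.measure] _root_.id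
  act_mul : ∀ g h, act (g * h) =ᵐ[M.measure] fun m => act h (act g m)

/-- Every sub-σ-algebra of a Lebesgue space is, up to null sets, generated by a map to a standard
Borel space: a point is sent to the values of its conditional measure on a countable generating
family of sets. -/
lemma exists_classifying_map {Ω : Type u} {m : MeasurableSpace Ω} [mΩ : MeasurableSpace Ω]
    [StandardBorelSpace Ω] (μ : Measure Ω) [IsProbabilityMeasure μ] (hm : m ≤ mΩ) :
    ∃ π : Ω → ULift.{u} ℚ → ℝ≥0∞, Measurable[m] π ∧ ∀ B, MeasurableSet[m] B →
      ∃ C, MeasurableSet C ∧ B =ᵐ[μ] π ⁻¹' C := by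
  have he : MeasurableEmbedding (embeddingReal Ω) := measurableEmbedding_embeddingReal Ω
  let A : ℚ → Set Ω := fun q => embeddingReal Ω ⁻¹' Set.Iic (q : ℝ)
  have hA : ∀ q, MeasurableSet (A q) := fun q => he.measurable measurableSet_Iic
  have hE : ∀ q : ULift.{u} ℚ, Measurable[m] fun ω => condExpKernel μ m ω (A q.down) :=
    fun q => measurable_condExpKernel (hA q.down)
  refine ⟨fun ω q => condExpKernel μ m ω (A q.down), by
    rw [@measurable_pi_iff]
    exact hE, fun B hB => ?_⟩
  have hgen : mΩ = MeasurableSpace.generateFrom (Set.range A) := by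
    rw [← he.comap_eq, Real.borelSpace.measurable_eq, Real.borel_eq_generateFrom_Iic_rat,
      MeasurableSpace.comap_generateFrom]
    congr 1
    ext s
    simp [A]
  have hpi : IsPiSystem (Set.range A) := by
    rintro _ ⟨p, rfl⟩ _ ⟨q, rfl⟩ _
    refine ⟨min p q, ?_⟩
    simp only [A, ← Set.preimage_inter, Set.Iic_inter_Iic, Rat.cast_min]
  have hκ : Measurable[MeasurableSpace.comap
      (fun ω (q : ULift.{u} ℚ) => condExpKernel μ m ω (A q.down)) inferInstance]
      fun ω => (condExpKernel μ m ω : Measure Ω) := by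
    refine @Measurable.measure_of_isPiSystem_of_isProbabilityMeasure Ω Ω (MeasurableSpace.comap
      (fun ω (q : ULift.{u} ℚ) => condExpKernel μ m ω (A q.down)) inferInstance) mΩ _
      (fun ω => IsMarkovKernel.isProbabilityMeasure (κ := condExpKernel μ m) ω)
        (Set.range A) hgen hpi ?_
    rintro _ ⟨q, rfl⟩
    exact (measurable_pi_apply (X := fun _ : ULift.{u} ℚ => ℝ≥0∞) (ULift.up.{u} q)).comp
      (comap_measurable (fun ω (q : ULift.{u} ℚ) => condExpKernel μ m ω (A q.down)))
  obtain ⟨C, hC, hCB⟩ := ((Measure.measurable_coe (hm B hB)).comp hκ) (measurableSet_singleton 1)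
  refine ⟨C, hC, ?_⟩
  rw [hCB]
  have h2 := condExpKernel_ae_eq_condExp (μ := μ) hm (hm B hB)
  have h3 : μ[B.indicator (fun _ => (1 : ℝ)) | m] = B.indicator (fun _ => (1 : ℝ)) :=
    condExp_of_stronglyMeasurable hm (stronglyMeasurable_const.indicator hB)
      ((integrable_const 1).indicator (hm B hB))
  rw [h3] at h2
  filter_upwards [h2] with ω hω
  change (ω ∈ B) = (condExpKernel μ m ω B = 1)
  have h4 : condExpKernel μ m ω B = 1 ↔ (condExpKernel μ m ω).real B = 1 := by
    rw [Measure.real, ENNReal.toReal_eq_one_iff]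
  rw [h4, show (condExpKernel μ m ω).real B = _ from hω]
  by_cases hωB : ω ∈ B <;> simp [hωB]

namespace QuasiAction

variable {G : Type v} [Group G] {M : LebesgueSpace.{u}} (S : QuasiAction G M)

/-- The measure `B ↦ μ(B g)` (the set `B g` is, up to a null set, the preimage of `B` under
`g⁻¹`). -/
def shifted (g : G) : Measure M := M.measure.map (S.act g⁻¹)

open Classical in
/-- The Radon--Nikodym derivative `g'`, characterized by `μ(B g) = ∫_B g' dμ`. (It takes values in
`(0, ∞)` almost everywhere; elsewhere it is set to `1`.) -/
def deriv (g : G) (m : M) : PosReal :=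
  if h : 0 < ((S.shifted g).rnDeriv M.measure m).toReal then ⟨_, h⟩ else 1

lemma measurable_act (g : G) : Measurable (S.act g) := (S.quasi g).measurable

lemma measurable_deriv (g : G) : Measurable (S.deriv g) := by
  refine Measurable.dite (s := {m | 0 < ((S.shifted g).rnDeriv M.measure m).toReal})
    (f := fun y => (⟨((S.shifted g).rnDeriv M.measure y).toReal, y.2⟩ : PosReal))
    (g := fun _ => 1)
    ?_ measurable_const ?_
  · apply Measurable.subtype_mk
    exact (Measure.measurable_rnDeriv _ _).ennreal_toReal.comp measurable_subtype_coe
  · exact measurableSet_lt measurable_const (Measure.measurable_rnDeriv _ _).ennreal_toReal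

lemma act_inv_act (g : G) : (fun m => S.act g (S.act g⁻¹ m)) =ᵐ[M.measure] _root_.id := by
  have h := S.act_mul g⁻¹ g
  rw [inv_mul_cancel] at h
  exact h.symm.trans S.act_one

lemma shifted_ac (g : G) : S.shifted g ≪ M.measure := (S.quasi g⁻¹).absolutelyContinuous

lemma ac_shifted (g : G) : M.measure ≪ S.shifted g := by
  refine Measure.AbsolutelyContinuous.mk fun B hB h0 => ?_
  rw [shifted, Measure.map_apply (S.measurable_act _) hB] at h0
  have h1 := (S.quasi g).preimage_null h0
  have h2 := S.act_inv_act g⁻¹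
  rw [inv_inv] at h2
  rw [← h1]
  refine measure_congr ?_
  filter_upwards [h2] with m hm
  change (m ∈ B) = (S.act g⁻¹ (S.act g m) ∈ B)
  rw [hm]
  rfl

instance instIsProbabilityMeasureShifted (g : G) : IsProbabilityMeasure (S.shifted g) :=
  Measure.isProbabilityMeasure_map (S.measurable_act _).aemeasurable

lemma toENNReal_deriv (g : G) : ∀ᵐ m ∂M.measure,
    (S.deriv g m).toENNReal = (S.shifted g).rnDeriv M.measure m := by
  filter_upwards [Measure.rnDeriv_pos' (S.ac_shifted g),
    Measure.rnDeriv_lt_top (S.shifted g) M.measure] with m h1 h2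
  have h3 : 0 < ((S.shifted g).rnDeriv M.measure m).toReal := ENNReal.toReal_pos h1.ne' h2.ne
  simp only [deriv, h3, dif_pos, PosReal.toENNReal]
  exact ENNReal.ofReal_toReal h2.ne

/-- The polymorphism of the transformation `g`: the image of the measure under
`m ↦ (m, m g, g'(m))`. -/
def polymorphism (g : G) : Polymorphism M M where
  toMeasure := M.measure.map (fun m => (m, S.act g m, S.deriv g m))
  map_fst := by
    have h1 := S.measurable_act g
    have h2 := S.measurable_deriv g
    refine Polymorphism.map_fst_of_lintegral fun f hf => ?_
    rw [lintegral_map (by fun_prop) (by fun_prop)]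
  map_snd := by
    have h1 := S.measurable_act g
    have h2 := S.measurable_deriv g
    refine Polymorphism.map_snd_of_lintegral fun f hf => ?_
    rw [lintegral_map (by fun_prop) (by fun_prop)]
    have h3 : ∫⁻ m, (S.deriv g m).toENNReal * f (S.act g m) ∂M.measure =
        ∫⁻ m, f (S.act g m) ∂(S.shifted g) := by
      rw [← lintegral_rnDeriv_mul (S.shifted_ac g) (by fun_prop)]
      refine lintegral_congr_ae ?_
      filter_upwards [S.toENNReal_deriv g] with m hm
      rw [hm]
    rw [h3, shifted, lintegral_map (by fun_prop) (S.measurable_act _)]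
    refine lintegral_congr_ae ?_
    filter_upwards [S.act_inv_act g] with m hm
    rw [hm]
    rfl

/-- The σ-algebra of `L`-invariant sets: measurable sets `B` such that `B` and `B g` differ by a
null set for each `g ∈ L`. -/
@[reducible] def invariantSigma (L : Subgroup G) : MeasurableSpace M where
  MeasurableSet' B := MeasurableSet B ∧ ∀ g ∈ L, S.act g ⁻¹' B =ᵐ[M.measure] B
  measurableSet_empty := ⟨MeasurableSet.empty, fun g _ => by simp⟩
  measurableSet_compl B hB := ⟨hB.1.compl, fun g hg => (hB.2 g hg).compl⟩
  measurableSet_iUnion B hB := ⟨MeasurableSet.iUnion fun i => (hB i).1, fun g hg => by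
    rw [Set.preimage_iUnion]
    exact Filter.EventuallyEq.countable_iUnion fun i => (hB i).2 g hg⟩

/-- The quotient of `M` by the σ-algebra of `L`-invariant sets: a probability Lebesgue space with a
measure preserving projection, such that the invariant sets are, up to null sets, precisely the
preimages of measurable sets. (It is unique up to an almost everywhere isomorphism over `M`.) -/
structure InvariantQuotient (L : Subgroup G) where
  space : LebesgueSpace.{u}
  proj : M → space
  measurePreserving : MeasurePreserving proj M.measure space.measure
  mem_iff : ∀ B : Set M, MeasurableSet B →
    (MeasurableSet[S.invariantSigma L] B ↔
      ∃ C : Set space, MeasurableSet C ∧ B =ᵐ[M.measure] proj ⁻¹' C)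

lemma invariantSigma_le (L : Subgroup G) : S.invariantSigma L ≤ M.measurableSpace :=
  fun _ hB => hB.1

lemma invariantSigma_congr (L : Subgroup G) {B C : Set M} (hB : MeasurableSet B)
    (hC : MeasurableSet[S.invariantSigma L] C) (h : B =ᵐ[M.measure] C) :
    MeasurableSet[S.invariantSigma L] B :=
  ⟨hB, fun g hg => (((S.quasi g).preimage_ae_eq h).trans (hC.2 g hg)).trans h.symm⟩

/-- The quotient space exists. -/
lemma nonempty_invariantQuotient (L : Subgroup G) : Nonempty (S.InvariantQuotient L) := by
  obtain ⟨π, hπ', hex⟩ := exists_classifying_map M.measure (S.invariantSigma_le L)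
  have hπ : Measurable π := hπ'.mono (S.invariantSigma_le L) le_rfl
  have : IsProbabilityMeasure (M.measure.map π) :=
    Measure.isProbabilityMeasure_map hπ.aemeasurable
  refine ⟨⟨⟨ULift.{u} ℚ → ℝ≥0∞, M.measure.map π⟩, π, ⟨hπ, rfl⟩, fun B hB => ⟨hex B, ?_⟩⟩⟩
  rintro ⟨C, hC, hBC⟩
  exact S.invariantSigma_congr L hB (hπ' hC) hBC

/-- The canonical measure preserving polymorphism from `M` to the quotient. -/
def InvariantQuotient.canonical {S : QuasiAction G M} {L : Subgroup G}
    (Q : S.InvariantQuotient L) : Polymorphism M Q.space :=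
  Polymorphism.ofMap Q.proj Q.measurePreserving

end QuasiAction

/-- An action of a `(G, K)`-pair on `M`: `G` acts continuously by transformations leaving the
measure quasi-invariant, and `K` acts by measure preserving transformations. -/
structure GKAction {G : Type v} [Group G] [TopologicalSpace G] {A : Type x} [PartialOrder A]
    (P : GKPair.{v, w, x} G A) (M : LebesgueSpace.{u}) extends QuasiAction G M where
  continuous : Continuous (fun g : G => toQuasiAction.polymorphism g)
  preserving : ∀ k ∈ P.K, MeasurePreserving (act k) M.measure M.measure

/-- The quotient spaces `M[α]` together with the projections `M → M[α]`. -/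
abbrev GKAction.Quotient {G : Type v} [Group G] [TopologicalSpace G] {A : Type x} [PartialOrder A]
    {P : GKPair.{v, w, x} G A} {M : LebesgueSpace.{u}} (S : GKAction P M) (α : A) :=
  S.toQuasiAction.InvariantQuotient (P.sub α)

/-- The polymorphism `Ξ_{α,β}(g) = 𝔵[α]⋆ g 𝔵[β]` from `M[α]` to `M[β]`, where `Qα`, `Qβ` are the
quotients `M[α]`, `M[β]`. -/
def GKAction.Xi {G : Type v} [Group G] [TopologicalSpace G] {A : Type x} [PartialOrder A]
    {P : GKPair.{v, w, x} G A} {M : LebesgueSpace.{u}} (S : GKAction P M) {α β : A}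
    (Qα : S.Quotient α) (Qβ : S.Quotient β) (g : G) : Qα.space ⟶ Qβ.space :=
  Polymorphism.comp (Polymorphism.star Qα.canonical)
    (Polymorphism.comp (S.polymorphism g) Qβ.canonical)

end

/-! The proof linearizes polymorphisms. For real `s`, a polymorphism `p` from `M` to `N` defines an
operator `T_s(p) : L²(N) → L²(M)` with matrix elements `∫ conj h(m) f(n) t^{1/2+is} dp(m,n,t)`. The
exponent has real part 1/2 because `|t^{1/2+is}|² = t`: this matches the marginal condition on `t •
p`, so each `T_s(p)` is a contraction. Products go to products, the involution to the adjoint,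
identities to identities (`operator_comp`, `operator_star`, `operator_id`). The whole family `T_s`,
with `s` real, is faithful (`eq_of_operator_eq`), since on indicators it gives the Mellin transforms
of the measures `p[B × C]` on a vertical line.

For an action, `ρ_s(g) = T_s(g)` is a strongly continuous unitary representation of `G` in the
separable space `L²(M)`. The group `K` preserves the measure, so `ρ_s` restricted to `K_α` is plain
composition and its fixed vectors are the functions on `M[α]`. Thus `J_α = T_s(𝔵[α])` is an isometry
of `L²(M[α])` onto `H(K_α)`, with `J_α* J_α = 1` and `J_α J_α* = P(K_α)`. Hence `T_s(Ξ_{α,β}(g)) =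
J_α* ρ_s(g) J_β` is the operator `P(K_α) ρ_s(g)` on `H(K_β)`, transported by these isometries.

The train is defined by equalities between such compressed operators in all unitary representations.
Applied to every `ρ_s`, they become equalities between the operators of the `Ξ`, and by faithfulness
between the polymorphisms themselves. -/

noncomputable section

/-! ### Characters `t^{1/2+is}` of the positive reals. -/

/-- The function `t ↦ t ^ (1/2 + i s)` on the positive reals. -/
def PosReal.cpow (s : ℝ) (t : PosReal) : ℂ :=
  (Real.sqrt t : ℂ) * Complex.exp (s * Real.log t * Complex.I)

namespace PosReal

lemma continuous_cpow (s : ℝ) : Continuous (cpow s) := by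
  have h : Continuous fun t : PosReal => Real.log t :=
    continuous_subtype_val.log fun t => t.2.ne'
  unfold cpow
  fun_prop

@[fun_prop] lemma measurable_cpow (s : ℝ) : Measurable (cpow s) :=
  (continuous_cpow s).measurable

lemma cpow_mul (s : ℝ) (t r : PosReal) : cpow s (t * r) = cpow s t * cpow s r := by
  have h1 : Real.log ((t : ℝ) * r) = Real.log t + Real.log r :=
    Real.log_mul t.2.ne' r.2.ne'
  have h2 : Real.sqrt ((t : ℝ) * r) = Real.sqrt t * Real.sqrt r := Real.sqrt_mul t.2.le _
  have h3 : ((t * r : PosReal) : ℝ) = t * r := rfl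
  rw [cpow, cpow, cpow, h3, h1, h2]
  push_cast
  rw [mul_add, add_mul, Complex.exp_add]
  ring

lemma cpow_one (s : ℝ) : cpow s 1 = 1 := by
  simp [cpow]

lemma norm_cpow (s : ℝ) (t : PosReal) : ‖cpow s t‖ = Real.sqrt t := by
  have h : (s * Real.log t * Complex.I : ℂ) = ((s * Real.log t : ℝ) : ℂ) * Complex.I := by
    push_cast; rfl
  rw [cpow, norm_mul, h, Complex.norm_exp_ofReal_mul_I, mul_one, Complex.norm_real,
    Real.norm_of_nonneg (Real.sqrt_nonneg _)]

lemma conj_cpow_mul_cpow (s : ℝ) (t : PosReal) :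
    (starRingEnd ℂ) (cpow s t) * cpow s t = (t : ℝ) := by
  rw [mul_comm, Complex.mul_conj, Complex.normSq_eq_norm_sq, norm_cpow, Real.sq_sqrt t.2.le]

/-- Specific to real part 1/2. It turns the density `t` and the inversion `t ↦ t⁻¹` in the
involution into complex conjugation, that is, into an adjoint. -/
lemma coe_mul_cpow_inv (s : ℝ) (t : PosReal) :
    ((t : ℝ) : ℂ) * cpow s t⁻¹ = (starRingEnd ℂ) (cpow s t) := by
  rw [← conj_cpow_mul_cpow s t, mul_assoc, ← cpow_mul, mul_inv_cancel, cpow_one, mul_one]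

lemma enorm_cpow_sq (s : ℝ) (t : PosReal) : ‖cpow s t‖ₑ ^ (2 : ℝ) = t.toENNReal := by
  rw [← ofReal_norm, norm_cpow, ENNReal.ofReal_rpow_of_nonneg (Real.sqrt_nonneg _) (by norm_num),
    toENNReal, Real.rpow_two, Real.sq_sqrt t.2.le]

end PosReal

/-! ### Operators of polymorphisms in `L²`. -/

/-- The complex Hilbert space of square integrable functions on a Lebesgue space. -/
abbrev LebesgueSpace.L2 (M : LebesgueSpace.{u}) : Type u := Lp ℂ 2 M.measure

namespace Polymorphism

variable {M N K : LebesgueSpace.{u}}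

lemma measurePreserving_fst (p : Polymorphism M N) :
    MeasurePreserving (fun z : M × N × PosReal => z.1) p.toMeasure M.measure :=
  ⟨by fun_prop, p.map_fst⟩

/-- Only `t • p` projects to the measure of `N`, but `t > 0`, so null sets still pull back to null
sets. This makes `f(n)` meaningful for an almost everywhere class `f`. -/
lemma quasiMeasurePreserving_snd (p : Polymorphism M N) :
    Measure.QuasiMeasurePreserving (fun z : M × N × PosReal => z.2.1) p.toMeasure N.measure where
  measurable := by fun_prop
  absolutelyContinuous := by
    refine Measure.AbsolutelyContinuous.mk fun B hB h => ?_
    rw [Measure.map_apply (by fun_prop) hB]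
    have h1 := p.ae_snd (P := fun n => n ∉ B) (measure_eq_zero_iff_ae_notMem.1 h)
    exact measure_eq_zero_iff_ae_notMem.2 h1

lemma lintegral_snd_of_aemeasurable (p : Polymorphism M N) {f : N → ℝ≥0∞}
    (hf : AEMeasurable f N.measure) :
    ∫⁻ z, z.2.2.toENNReal * f z.2.1 ∂p.toMeasure = ∫⁻ n, f n ∂N.measure := by
  rw [lintegral_congr_ae hf.ae_eq_mk, ← p.lintegral_snd hf.measurable_mk]
  refine lintegral_congr_ae ?_
  filter_upwards [p.quasiMeasurePreserving_snd.ae_eq hf.ae_eq_mk] with z hz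
  simp only [Function.comp_apply] at hz
  rw [hz]

lemma eLpNorm_cpow_mul_snd (p : Polymorphism M N) (s : ℝ) {f : N → ℂ}
    (hf : AEStronglyMeasurable f N.measure) :
    eLpNorm (fun z => PosReal.cpow s z.2.2 * f z.2.1) 2 p.toMeasure =
      eLpNorm f 2 N.measure := by
  rw [eLpNorm_eq_lintegral_rpow_enorm_toReal (by norm_num) (by norm_num),
    eLpNorm_eq_lintegral_rpow_enorm_toReal (by norm_num) (by norm_num),
    ← p.lintegral_snd_of_aemeasurable (hf.enorm.pow_const _)]
  simp only [enorm_mul, ENNReal.toReal_ofNat, ENNReal.mul_rpow_of_nonneg _ _ zero_le_two,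
    PosReal.enorm_cpow_sq]

lemma memLp_cpow_mul_snd (p : Polymorphism M N) (s : ℝ) {f : N → ℂ}
    (hf : MemLp f 2 N.measure) :
    MemLp (fun z => PosReal.cpow s z.2.2 * f z.2.1) 2 p.toMeasure := by
  refine ⟨?_, ?_⟩
  · exact AEStronglyMeasurable.mul
      ((PosReal.measurable_cpow s).comp (by fun_prop)).aestronglyMeasurable
      (hf.1.comp_quasiMeasurePreserving p.quasiMeasurePreserving_snd)
  · rw [p.eLpNorm_cpow_mul_snd s hf.1]
    exact hf.2

/-- The isometric embedding `f ↦ f(n) t^{1/2 + i s}`. -/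
def embedSnd (p : Polymorphism M N) (s : ℝ) : N.L2 →ₗᵢ[ℂ] Lp ℂ 2 p.toMeasure where
  toFun f := (p.memLp_cpow_mul_snd s (Lp.memLp f)).toLp _
  map_add' f g := by
    rw [← MemLp.toLp_add, MemLp.toLp_eq_toLp_iff]
    filter_upwards [p.quasiMeasurePreserving_snd.ae_eq (Lp.coeFn_add f g)] with z hz
    simp only [Function.comp_apply, Pi.add_apply] at hz ⊢
    rw [hz, mul_add]
  map_smul' c f := by
    rw [RingHom.id_apply, ← MemLp.toLp_const_smul, MemLp.toLp_eq_toLp_iff]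
    filter_upwards [p.quasiMeasurePreserving_snd.ae_eq (Lp.coeFn_smul c f)] with z hz
    simp only [Function.comp_apply, Pi.smul_apply, smul_eq_mul] at hz ⊢
    rw [hz, mul_left_comm]
  norm_map' f := by
    change ‖(p.memLp_cpow_mul_snd s (Lp.memLp f)).toLp _‖ = ‖f‖
    rw [Lp.norm_toLp, p.eLpNorm_cpow_mul_snd s (Lp.aestronglyMeasurable f), Lp.norm_def]

/-- The isometric embedding `h ↦ h(m)`. -/
def embedFst (p : Polymorphism M N) : M.L2 →ₗᵢ[ℂ] Lp ℂ 2 p.toMeasure :=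
  Lp.compMeasurePreservingₗᵢ ℂ _ p.measurePreserving_fst

/-- The operator of a polymorphism, whose matrix elements are
`⟪h, T f⟫ = ∫ conj h(m) f(n) t^{1/2 + i s} dp(m, n, t)`. -/
def operator (p : Polymorphism M N) (s : ℝ) : N.L2 →L[ℂ] M.L2 :=
  (ContinuousLinearMap.adjoint p.embedFst.toContinuousLinearMap) ∘L
    (p.embedSnd s).toContinuousLinearMap

lemma inner_operator (p : Polymorphism M N) (s : ℝ) (h : M.L2) (f : N.L2) :
    inner ℂ h (p.operator s f) =
      ∫ z, (starRingEnd ℂ) (h z.1) * (PosReal.cpow s z.2.2 * f z.2.1) ∂p.toMeasure := by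
  rw [operator, ContinuousLinearMap.comp_apply, ContinuousLinearMap.adjoint_inner_right,
    L2.inner_def]
  refine integral_congr_ae ?_
  filter_upwards [Lp.coeFn_compMeasurePreserving h p.measurePreserving_fst,
    (p.memLp_cpow_mul_snd s (Lp.memLp f)).coeFn_toLp] with z h1 h2
  change inner ℂ (Lp.compMeasurePreserving _ p.measurePreserving_fst h z)
    ((p.memLp_cpow_mul_snd s (Lp.memLp f)).toLp _ z) = _
  rw [h1, h2, RCLike.inner_apply, mul_comm]
  rfl

lemma integrable_inner (p : Polymorphism M N) (s : ℝ) {h : M → ℂ} {f : N → ℂ}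
    (hh : MemLp h 2 M.measure) (hf : MemLp f 2 N.measure) :
    Integrable (fun z => (starRingEnd ℂ) (h z.1) * (PosReal.cpow s z.2.2 * f z.2.1))
      p.toMeasure :=
  (hh.comp_measurePreserving p.measurePreserving_fst).star.integrable_mul
    (p.memLp_cpow_mul_snd s hf)

/-- The operator of a polymorphism in terms of the conditional measures. -/
lemma operator_apply_ae (p : Polymorphism M N) (s : ℝ) (f : N.L2) :
    p.operator s f =ᵐ[M.measure] fun m => ∫ y, PosReal.cpow s y.2 * f y.1 ∂p.spread m := by
  have key : ∀ {h : M → ℂ}, MemLp h 2 M.measure →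
      Integrable (fun m => ∫ y, (starRingEnd ℂ) (h m) * (PosReal.cpow s y.2 * f y.1)
        ∂p.spread m) M.measure := by
    intro h hh
    have h1 := p.integrable_inner s hh (Lp.memLp f)
    rw [← p.compProd_spread] at h1
    exact h1.integral_compProd
  refine Integrable.ae_eq_of_forall_setIntegral_eq _ _
    ((Lp.memLp _).integrable one_le_two) ?_ fun B hB _ => ?_
  -- Integrability of the candidate function is the case `h = 1`; below, equality is tested against
  -- the indicators of measurable sets `B`.
  · simpa using key (h := fun _ => 1) (memLp_const _)
  · have h1 := p.inner_operator s (indicatorConstLp 2 hB (measure_ne_top _ _) (1 : ℂ)) f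
    rw [L2.inner_indicatorConstLp_one] at h1
    have h2 : MemLp (B.indicator fun _ => (1 : ℂ)) 2 M.measure := memLp_indicator_const 2 hB 1
      (Or.inr (measure_ne_top _ _))
    have h3 := p.integrable_inner s h2 (Lp.memLp f)
    rw [h1, ← integral_indicator hB]
    rw [← p.compProd_spread] at h3
    calc _ = ∫ z, (starRingEnd ℂ) (B.indicator (fun _ => (1 : ℂ)) z.1) *
          (PosReal.cpow s z.2.2 * f z.2.1) ∂p.toMeasure := by
          refine integral_congr_ae ?_
          filter_upwards [p.measurePreserving_fst.quasiMeasurePreserving.ae_eq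
            (indicatorConstLp_coeFn (p := 2) (hs := hB)
              (hμs := measure_ne_top M.measure B) (c := (1 : ℂ)))] with z hz
          simp only [Function.comp_apply] at hz
          rw [hz]
      _ = _ := by
          rw [← p.compProd_spread, Measure.integral_compProd h3]
          refine integral_congr_ae (Filter.Eventually.of_forall fun m => ?_)
          by_cases hm : m ∈ B <;> simp [hm]

lemma integrable_compMeasure_iff (p : Polymorphism M N) (q : Polymorphism N K)
    {F : M × K × PosReal → ℂ} (hF : AEStronglyMeasurable F (comp p q).toMeasure) :
    Integrable F (comp p q).toMeasure ↔
      Integrable (fun y : (M × N × PosReal) × K × PosReal => F (y.1.1, y.2.1, y.1.2.2 * y.2.2))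
        (p.toMeasure ⊗ₘ q.spread.comap (fun z : M × N × PosReal => z.2.1) (by fun_prop)) :=
  integrable_map_measure hF (by fun_prop)

lemma integral_comp (p : Polymorphism M N) (q : Polymorphism N K)
    {F : M × K × PosReal → ℂ} (hF : Integrable F (comp p q).toMeasure) :
    ∫ z, F z ∂(comp p q).toMeasure =
      ∫ z, ∫ y, F (z.1, y.1, z.2.2 * y.2) ∂q.spread z.2.1 ∂p.toMeasure := by
  have h1 := (integrable_compMeasure_iff p q hF.1).1 hF
  change ∫ z, F z ∂(Measure.map _ _) = _
  rw [integral_map (by fun_prop) hF.1, Measure.integral_compProd h1]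
  rfl

/-- The product multiplies the coordinates `t`, and `t^{1/2+is}` is a character, so the integral
over the second factor splits off as the function `T_s(q) f` evaluated at the intermediate point. -/
lemma operator_comp (p : Polymorphism M N) (q : Polymorphism N K) (s : ℝ) :
    (comp p q).operator s = p.operator s ∘L q.operator s := by
  refine ContinuousLinearMap.ext fun f => ext_inner_left ℂ fun h => ?_
  rw [inner_operator, ContinuousLinearMap.comp_apply, inner_operator,
    integral_comp p q ((comp p q).integrable_inner s (Lp.memLp h) (Lp.memLp f))]
  refine integral_congr_ae ?_
  filter_upwards [p.quasiMeasurePreserving_snd.ae_eq (q.operator_apply_ae s f)] with z hz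
  simp only [Function.comp_apply] at hz
  rw [hz, ← integral_const_mul, ← integral_const_mul]
  refine integral_congr_ae (Filter.Eventually.of_forall fun y => ?_)
  simp only [PosReal.cpow_mul, mul_assoc]

lemma operator_star (p : Polymorphism M N) (s : ℝ) :
    (star p).operator s = ContinuousLinearMap.adjoint (p.operator s) := by
  refine ContinuousLinearMap.ext fun f => ext_inner_left ℂ fun h => ?_
  have h0 := ((star p).integrable_inner s (Lp.memLp h) (Lp.memLp f)).1
  rw [ContinuousLinearMap.adjoint_inner_right, inner_operator,
    ← inner_conj_symm, inner_operator, ← integral_conj]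
  change AEStronglyMeasurable _ (Measure.map _ _) at h0
  change ∫ z, _ ∂(Measure.map _ _) = _
  rw [integral_map (by fun_prop) h0, integral_withDensity_eq_integral_toReal_smul
    (f := fun z : M × N × PosReal => z.2.2.toENNReal) (by fun_prop) (Filter.Eventually.of_forall fun z => ENNReal.ofReal_lt_top)]
  refine integral_congr_ae (Filter.Eventually.of_forall fun z => ?_)
  have h1 : z.2.2.toENNReal.toReal = z.2.2 := ENNReal.toReal_ofReal z.2.2.2.le
  simp only [h1, Complex.real_smul, map_mul, Complex.conj_conj, ← PosReal.coe_mul_cpow_inv]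
  ring

lemma integral_ofMap (π : M → N) (hπ : MeasurePreserving π M.measure N.measure)
    {F : M × N × PosReal → ℂ} (hF : AEStronglyMeasurable F (ofMap π hπ).toMeasure) :
    ∫ z, F z ∂(ofMap π hπ).toMeasure = ∫ m, F (m, π m, 1) ∂M.measure := by
  have := hπ.measurable
  change ∫ z, F z ∂(Measure.map _ _) = _
  rw [integral_map (by fun_prop) hF]

/-- The measure lives on `t = 1`, where the character is 1 for every `s`. -/
lemma operator_ofMap (π : M → N) (hπ : MeasurePreserving π M.measure N.measure) (s : ℝ)
    (f : N.L2) : (ofMap π hπ).operator s f = Lp.compMeasurePreserving π hπ f := by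
  refine ext_inner_left ℂ fun h => ?_
  rw [inner_operator, integral_ofMap π hπ
    ((ofMap π hπ).integrable_inner s (Lp.memLp h) (Lp.memLp f)).1, L2.inner_def]
  refine integral_congr_ae ?_
  filter_upwards [Lp.coeFn_compMeasurePreserving f hπ] with m hm
  rw [hm, RCLike.inner_apply, PosReal.cpow_one, one_mul, mul_comm]
  rfl

lemma operator_id (s : ℝ) : (id M).operator s = ContinuousLinearMap.id ℂ M.L2 := by
  refine ContinuousLinearMap.ext fun f => Lp.ext ?_
  rw [id, operator_ofMap]
  exact Lp.coeFn_compMeasurePreserving f _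

/-- Links operators with the measures `p[B × C]`; both faithfulness and continuity of `T_s` rest on
it. -/
lemma inner_operator_indicator (p : Polymorphism M N) (s : ℝ) {B : Set M} {C : Set N}
    (hB : MeasurableSet B) (hC : MeasurableSet C) :
    inner ℂ (indicatorConstLp 2 hB (measure_ne_top M.measure B) (1 : ℂ))
      (p.operator s (indicatorConstLp 2 hC (measure_ne_top N.measure C) (1 : ℂ))) =
    ∫ t, PosReal.cpow s t ∂(p.block B C : Measure PosReal) := by
  have hBC : MeasurableSet (B ×ˢ C ×ˢ (Set.univ : Set PosReal)) :=
    hB.prod (hC.prod MeasurableSet.univ)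
  change _ = ∫ t, _ ∂(Measure.map _ _)
  rw [inner_operator, integral_map (by fun_prop) (by fun_prop), ← integral_indicator hBC]
  refine integral_congr_ae ?_
  filter_upwards [p.measurePreserving_fst.quasiMeasurePreserving.ae_eq
    (indicatorConstLp_coeFn (p := 2) (hs := hB)
      (hμs := measure_ne_top M.measure B) (c := (1 : ℂ))),
    p.quasiMeasurePreserving_snd.ae_eq
    (indicatorConstLp_coeFn (p := 2) (hs := hC)
      (hμs := measure_ne_top N.measure C) (c := (1 : ℂ)))] with z h1 h2
  simp only [Function.comp_apply] at h1 h2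
  rw [h1, h2]
  by_cases hz : z.1 ∈ B <;> by_cases hz' : z.2.1 ∈ C <;> simp [hz, hz', Set.indicator]

end Polymorphism

/-! ### Faithfulness: injectivity of the Mellin transform. -/

namespace PosReal

/-- A finite measure on the positive reals with finite first moment is determined by its Mellin
transform on the line `Re z = 1/2`. -/
lemma measure_ext_of_integral_cpow {μ ν : Measure PosReal}
    (hμ : Integrable (cpow 0) μ) (hν : Integrable (cpow 0) ν)
    (h : ∀ s, ∫ t, cpow s t ∂μ = ∫ t, cpow s t ∂ν) : μ = ν := by
  -- Weighting by `√t = |t^{1/2+is}|` and passing to `log t` turns the Mellin transform into the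
  -- characteristic function of a finite measure on the line. Both operations are invertible
  -- (`hmap`, `hinv`).
  let w : PosReal → ℝ≥0∞ := fun t => ENNReal.ofReal (Real.sqrt t)
  have hw : Measurable w := by
    have : Measurable fun t : PosReal => (t : ℝ) := measurable_subtype_coe
    fun_prop
  let l : PosReal → ℝ := fun t => Real.log t
  have hl : Measurable l := Real.measurable_log.comp measurable_subtype_coe
  let e : ℝ → PosReal := fun r => ⟨Real.exp r, Real.exp_pos r⟩
  have he : Measurable e := Real.measurable_exp.subtype_mk
  have hel : e ∘ l = _root_.id := by
    funext t
    exact Subtype.ext (Real.exp_log t.2)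
  have hfin : ∀ {η : Measure PosReal}, Integrable (cpow 0) η →
      IsFiniteMeasure (η.withDensity w) := by
    intro η hη
    refine isFiniteMeasure_withDensity (ne_of_lt ?_)
    have h1 := hη.norm.lintegral_lt_top
    simpa only [norm_cpow] using h1
  have hchar : ∀ (η : Measure PosReal) (s : ℝ),
      charFun ((η.withDensity w).map l) s = ∫ t, cpow s t ∂η := by
    intro η s
    rw [charFun_apply_real, integral_map hl.aemeasurable
      (by fun_prop), integral_withDensity_eq_integral_toReal_smul hw
      (Filter.Eventually.of_forall fun t => ENNReal.ofReal_lt_top)]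
    refine integral_congr_ae (Filter.Eventually.of_forall fun t => ?_)
    have h1 : (w t).toReal = Real.sqrt t := ENNReal.toReal_ofReal (Real.sqrt_nonneg _)
    simp only [h1, Complex.real_smul]
    rfl
  have hmap : ∀ η : Measure PosReal, (η.map l).map e = η := by
    intro η
    rw [Measure.map_map he hl, hel, Measure.map_id]
  have hinv : ∀ η : Measure PosReal,
      (η.withDensity w).withDensity (fun t => (w t)⁻¹) = η := by
    intro η
    refine withDensity_inv_same hw (Filter.Eventually.of_forall fun t => ?_)
      (Filter.Eventually.of_forall fun t => ENNReal.ofReal_ne_top)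
    exact (ENNReal.ofReal_pos.2 (Real.sqrt_pos.2 t.2)).ne'
  have := hfin hμ
  have := hfin hν
  have hlog : (μ.withDensity w).map l = (ν.withDensity w).map l := by
    refine Measure.ext_of_charFun (funext fun s => ?_)
    rw [hchar, hchar, h]
  rw [← hinv μ, ← hinv ν, ← hmap (μ.withDensity w), ← hmap (ν.withDensity w), hlog]

end PosReal

namespace Polymorphism

variable {M N : LebesgueSpace.{u}}

lemma integrable_cpow_block (p : Polymorphism M N) (s : ℝ) (B : Set M) (C : Set N) :
    Integrable (PosReal.cpow s) (p.block B C : Measure PosReal) := by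
  -- With `f = 1` the character is square integrable for a probability measure, hence integrable.
  have h1 := (p.memLp_cpow_mul_snd s (f := fun _ => 1) (memLp_const _)).integrable one_le_two
  simp only [mul_one] at h1
  change Integrable _ (Measure.map _ _)
  rw [integrable_map_measure (by fun_prop) (by fun_prop)]
  exact h1.restrict

/-- A polymorphism is determined by its operators. -/
lemma eq_of_operator_eq {p q : Polymorphism M N} (h : ∀ s, p.operator s = q.operator s) :
    p = q := by
  refine Polymorphism.ext (Measure.ext_prod₃ fun {B C U} hB hC hU => ?_)
  have hblock : (p.block B C : Measure PosReal) = q.block B C := by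
    refine PosReal.measure_ext_of_integral_cpow (p.integrable_cpow_block 0 B C)
      (q.integrable_cpow_block 0 B C) fun s => ?_
    rw [← inner_operator_indicator p s hB hC, ← inner_operator_indicator q s hB hC, h]
  have happ : ∀ r : Polymorphism M N,
      r.toMeasure (B ×ˢ C ×ˢ U) = (r.block B C : Measure PosReal) U := by
    intro r
    change _ = (Measure.map _ _) U
    rw [Measure.map_apply (by fun_prop) hU, Measure.restrict_apply
      ((by fun_prop : Measurable fun z : M × N × PosReal => z.2.2) hU)]
    congr 1
    ext z
    simp only [Set.mem_prod, Set.mem_inter_iff, Set.mem_preimage, Set.mem_univ, and_true]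
    tauto
  rw [happ p, happ q, hblock]

/-! ### Polymorphisms given by maps -/

lemma lintegral_ofMap (π : M → N) (hπ : MeasurePreserving π M.measure N.measure)
    {f : M × N × PosReal → ℝ≥0∞} (hf : Measurable f) :
    ∫⁻ z, f z ∂(ofMap π hπ).toMeasure = ∫⁻ m, f (m, π m, 1) ∂M.measure := by
  have := hπ.measurable
  change ∫⁻ z, f z ∂(Measure.map _ _) = _
  rw [lintegral_map hf (by fun_prop)]

lemma lintegral_star (p : Polymorphism M N) {f : N × M × PosReal → ℝ≥0∞} (hf : Measurable f) :
    ∫⁻ z, f z ∂(star p).toMeasure =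
      ∫⁻ z, z.2.2.toENNReal * f (z.2.1, z.1, z.2.2⁻¹) ∂p.toMeasure := by
  change ∫⁻ z, f z ∂(Measure.map _ _) = _
  rw [lintegral_map hf (by fun_prop),
    lintegral_withDensity_eq_lintegral_mul _ (by fun_prop) (by fun_prop)]
  rfl

/-- On operators the claim is `J* J = 1` for the isometry `J f = f ∘ π`; faithfulness brings it back
to polymorphisms. -/
lemma star_ofMap_comp_ofMap (π : M → N) (hπ : MeasurePreserving π M.measure N.measure) :
    comp (star (ofMap π hπ)) (ofMap π hπ) = id N := by
  refine eq_of_operator_eq fun s => ?_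
  rw [operator_comp, operator_star, operator_id]
  refine ContinuousLinearMap.ext fun f => ext_inner_left ℂ fun h => ?_
  rw [ContinuousLinearMap.comp_apply, ContinuousLinearMap.adjoint_inner_right, operator_ofMap,
    operator_ofMap]
  exact (Lp.compMeasurePreservingₗᵢ ℂ π hπ).inner_map_map h f

end Polymorphism

/-! ### The unitary operators of a quasi-invariant action. -/

namespace QuasiAction

variable {G : Type v} [Group G] {M : LebesgueSpace.{u}} (S : QuasiAction G M)

lemma lintegral_polymorphism (g : G) {f : M × M × PosReal → ℝ≥0∞} (hf : Measurable f) :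
    ∫⁻ z, f z ∂(S.polymorphism g).toMeasure =
      ∫⁻ m, f (m, S.act g m, S.deriv g m) ∂M.measure := by
  have h1 := S.measurable_act g
  have h2 := S.measurable_deriv g
  change ∫⁻ z, f z ∂(Measure.map _ _) = _
  rw [lintegral_map hf (by fun_prop)]

/-- The second marginal condition of `S.polymorphism g`, read as the change of variables formula. -/
lemma lintegral_deriv_mul (g : G) {f : M → ℝ≥0∞} (hf : Measurable f) :
    ∫⁻ m, (S.deriv g m).toENNReal * f (S.act g m) ∂M.measure = ∫⁻ m, f m ∂M.measure := by
  rw [← (S.polymorphism g).lintegral_snd hf, S.lintegral_polymorphism g (by fun_prop)]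

lemma ae_act (g : G) {P : M → Prop} (h : ∀ᵐ m ∂M.measure, P m) :
    ∀ᵐ m ∂M.measure, P (S.act g m) :=
  (S.quasi g).ae h

/-- The change of variables formula characterizes the Radon--Nikodym derivative. -/
lemma ae_eq_deriv (g : G) {D : M → PosReal} (hD : Measurable D)
    (h : ∀ f : M → ℝ≥0∞, Measurable f →
      ∫⁻ m, (D m).toENNReal * f (S.act g m) ∂M.measure = ∫⁻ m, f m ∂M.measure) :
    D =ᵐ[M.measure] S.deriv g := by
  have h1 := S.measurable_deriv g
  have key : (fun m => (D m).toENNReal) =ᵐ[M.measure] fun m => (S.deriv g m).toENNReal := by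
    refine ae_eq_of_forall_setLIntegral_eq_of_sigmaFinite (by fun_prop) (by fun_prop)
      fun B hB _ => ?_
    have h2 := S.measurable_act g⁻¹
    have h3 : Measurable fun m => B.indicator (1 : M → ℝ≥0∞) (S.act g⁻¹ m) :=
      (measurable_one.indicator hB).comp h2
    -- Up to null sets `g` is invertible, so the indicator of any `B` has the form `f (S.act g m)`
    -- and the formula tests integrals over all measurable sets.
    have h4 : ∀ E : M → PosReal, Measurable E →
        ∫⁻ m in B, (E m).toENNReal ∂M.measure =
        ∫⁻ m, (E m).toENNReal * B.indicator (1 : M → ℝ≥0∞) (S.act g⁻¹ (S.act g m))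
          ∂M.measure := by
      intro E hE
      rw [← lintegral_indicator hB]
      have h5 := S.act_inv_act g⁻¹
      rw [inv_inv] at h5
      refine lintegral_congr_ae ?_
      filter_upwards [h5] with m hm
      rw [hm]
      by_cases hmB : m ∈ B <;> simp [hmB]
    rw [h4 D hD, h4 _ h1, h _ h3, S.lintegral_deriv_mul g h3]
  filter_upwards [key] with m hm
  have h2 := (ENNReal.ofReal_eq_ofReal_iff (D m).2.le (S.deriv g m).2.le).1 hm
  exact Subtype.ext h2

/-- The chain rule: changing variables by `h` and by `g` shows that the left side satisfies the
formula characterizing the derivative of `g * h`. -/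
lemma deriv_mul (g h : G) :
    (fun m => S.deriv g m * S.deriv h (S.act g m)) =ᵐ[M.measure] S.deriv (g * h) := by
  have h1 := S.measurable_deriv g
  have h2 := S.measurable_deriv h
  have h3 := S.measurable_act g
  have h4 := S.measurable_act h
  refine S.ae_eq_deriv _ (by fun_prop) fun f hf => ?_
  rw [← S.lintegral_deriv_mul h hf, ← S.lintegral_deriv_mul g
    (f := fun m => (S.deriv h m).toENNReal * f (S.act h m)) (by fun_prop)]
  refine lintegral_congr_ae ?_
  filter_upwards [S.act_mul g h] with m hm
  rw [hm, PosReal.toENNReal_mul, mul_assoc]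

lemma deriv_of_measurePreserving {g : G} (hg : MeasurePreserving (S.act g) M.measure M.measure) :
    S.deriv g =ᵐ[M.measure] fun _ => 1 := by
  refine (S.ae_eq_deriv g measurable_const fun f hf => ?_).symm
  simp only [PosReal.toENNReal_one, one_mul]
  exact hg.lintegral_comp hf

lemma deriv_one : S.deriv 1 =ᵐ[M.measure] fun _ => 1 :=
  S.deriv_of_measurePreserving
    ⟨S.measurable_act 1, by rw [Measure.map_congr S.act_one, Measure.map_id]⟩

lemma polymorphism_one : S.polymorphism 1 = Polymorphism.id M := by
  refine Polymorphism.ext_lintegral fun f hf => ?_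
  rw [S.lintegral_polymorphism 1 hf, Polymorphism.lintegral_id hf]
  refine lintegral_congr_ae ?_
  filter_upwards [S.act_one, S.deriv_one] with m h1 h2
  rw [h1, h2]
  rfl

/-- The conditional measures are point masses, so products with such polymorphisms become
substitutions. -/
lemma spread_polymorphism (g : G) : ∀ᵐ m ∂M.measure, (S.polymorphism g).spread m =
    Kernel.deterministic (fun m => (S.act g m, S.deriv g m))
      ((S.measurable_act g).prodMk (S.measurable_deriv g)) m := by
  have h1 := (S.measurable_act g).prodMk (S.measurable_deriv g)
  refine Polymorphism.spread_ae_eq _ _ (Measure.ext_of_lintegral _ fun f hf => ?_)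
  rw [S.lintegral_polymorphism g hf, Measure.lintegral_compProd hf]
  refine lintegral_congr fun m => ?_
  rw [Kernel.lintegral_deterministic' h1 (by fun_prop)]

lemma polymorphism_mul (g h : G) :
    S.polymorphism (g * h) = Polymorphism.comp (S.polymorphism g) (S.polymorphism h) := by
  have h1 := S.measurable_act g
  have h2 := S.measurable_deriv g
  refine Polymorphism.ext_lintegral fun f hf => ?_
  rw [S.lintegral_polymorphism _ hf, Polymorphism.lintegral_comp _ _ hf,
    S.lintegral_polymorphism g]
  · refine lintegral_congr_ae ?_
    filter_upwards [S.act_mul g h, S.deriv_mul g h, S.ae_act g (S.spread_polymorphism h)]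
      with m h3 h4 h5
    rw [h5, Kernel.lintegral_deterministic' _ (by fun_prop), h3, ← h4]
  · exact (S.polymorphism h).measurable_lintegral_spread (by fun_prop) (by fun_prop)

/-- Substituting `m ↦ m g` reduces this to the chain rule for `g * g⁻¹`. With `operator_star` it
gives unitarity. -/
lemma polymorphism_inv (g : G) :
    S.polymorphism g⁻¹ = Polymorphism.star (S.polymorphism g) := by
  have h1 := S.measurable_act g⁻¹
  have h2 := S.measurable_deriv g⁻¹
  refine Polymorphism.ext_lintegral fun f hf => ?_
  rw [S.lintegral_polymorphism _ hf, Polymorphism.lintegral_star _ hf,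
    S.lintegral_polymorphism g (by fun_prop), ← S.lintegral_deriv_mul g (by fun_prop)]
  have h3 := S.deriv_mul g g⁻¹
  have h4 := S.act_inv_act g⁻¹
  rw [mul_inv_cancel] at h3
  rw [inv_inv] at h4
  refine lintegral_congr_ae ?_
  filter_upwards [h3, h4, S.deriv_one] with m h5 h6 h7
  rw [h7] at h5
  rw [h6, eq_inv_of_mul_eq_one_right h5]
  rfl

/-- The unitary operators of a quasi-invariant action. -/
def unitaryHom (s : ℝ) : G →* unitary (M.L2 →L[ℂ] M.L2) where
  toFun g := ⟨(S.polymorphism g).operator s, by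
    rw [Unitary.mem_iff, ContinuousLinearMap.star_eq_adjoint, ← Polymorphism.operator_star,
      ← S.polymorphism_inv]
    constructor
    · change _ ∘L _ = _
      rw [← Polymorphism.operator_comp, ← S.polymorphism_mul, inv_mul_cancel,
        S.polymorphism_one, Polymorphism.operator_id]
      rfl
    · change _ ∘L _ = _
      rw [← Polymorphism.operator_comp, ← S.polymorphism_mul, mul_inv_cancel,
        S.polymorphism_one, Polymorphism.operator_id]
      rfl⟩
  map_one' := Subtype.ext (by
    change (S.polymorphism 1).operator s = _
    rw [S.polymorphism_one, Polymorphism.operator_id]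
    rfl)
  map_mul' g h := Subtype.ext (by
    change (S.polymorphism (g * h)).operator s = _ ∘L _
    rw [S.polymorphism_mul, Polymorphism.operator_comp])

end QuasiAction

/-! ### Continuity of the operators -/

/-- In a uniformly Lipschitz family of functions of `x`, the parameters for which the function is
continuous form a closed set. -/
lemma isClosed_setOf_continuous_of_lipschitzWith {X E F : Type*} [TopologicalSpace X]
    [PseudoMetricSpace E] [PseudoMetricSpace F] {Φ : E → X → F} {C : NNReal}
    (hΦ : ∀ x, LipschitzWith C fun e => Φ e x) : IsClosed {e | Continuous (Φ e)} := by
  refine isClosed_of_closure_subset fun e he => ?_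
  refine continuous_of_uniform_approx_of_continuous fun U hU => ?_
  obtain ⟨ε, hε, hεU⟩ := Metric.mem_uniformity_dist.1 hU
  -- `C + 1` replaces `C`, which may be zero, as a divisor.
  have hC : (0 : ℝ) < C + 1 := by positivity
  obtain ⟨e', he', hd⟩ := Metric.mem_closure_iff.1 he (ε / (C + 1)) (by positivity)
  refine ⟨Φ e', he', fun x => hεU ?_⟩
  calc dist (Φ e x) (Φ e' x) ≤ C * dist e e' := (hΦ x).dist_le_mul e e'
    _ ≤ (C + 1) * dist e e' := by gcongr; linarith
    _ < (C + 1) * (ε / (C + 1)) := by gcongr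
    _ = ε := by field_simp

lemma indicatorConstLp_eq_smul_one {Ω : Type*} [MeasurableSpace Ω] {μ : Measure Ω} {B : Set Ω}
    (hB : MeasurableSet B) (h : μ B ≠ ⊤) (c : ℂ) :
    indicatorConstLp 2 hB h c = c • indicatorConstLp 2 hB h (1 : ℂ) := by
  refine Lp.ext ?_
  filter_upwards [indicatorConstLp_coeFn (p := 2) (hs := hB) (hμs := h) (c := c),
    Lp.coeFn_smul c (indicatorConstLp 2 hB h (1 : ℂ)),
    indicatorConstLp_coeFn (p := 2) (hs := hB) (hμs := h) (c := (1 : ℂ))] with ω h1 h2 h3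
  rw [h1, h2, Pi.smul_apply, h3]
  by_cases hω : ω ∈ B <;> simp [hω]

/-- Density of the span of indicators in the space of square integrable functions. -/
lemma L2_induction {Ω : Type*} [MeasurableSpace Ω] {μ : Measure Ω} [IsFiniteMeasure μ]
    (P : Lp ℂ 2 μ → Prop)
    (h_ind : ∀ (B : Set Ω) (hB : MeasurableSet B),
      P (indicatorConstLp 2 hB (measure_ne_top μ B) (1 : ℂ)))
    (h_smul : ∀ (c : ℂ) f, P f → P (c • f)) (h_add : ∀ f g, P f → P g → P (f + g))
    (h_closed : IsClosed {f | P f}) (f : Lp ℂ 2 μ) : P f := by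
  refine Lp.induction (by norm_num) P (fun c B hB hμB => ?_)
    (fun f g hf hg _ h1 h2 => h_add _ _ h1 h2) h_closed f
  rw [Lp.simpleFunc.coe_indicatorConst, indicatorConstLp_eq_smul_one]
  exact h_smul c _ (h_ind B hB)

namespace PosReal

lemma norm_cpow_div_le (s : ℝ) (t : PosReal) : ‖cpow s t / (1 + (t : ℝ) : ℂ)‖ ≤ 1 := by
  have ht : (0 : ℝ) < 1 + t := by have := t.2; linarith
  have h1 : (1 + (t : ℝ) : ℂ) = ((1 + t : ℝ) : ℂ) := by push_cast; rfl
  rw [norm_div, norm_cpow, h1, Complex.norm_real, Real.norm_of_nonneg ht.le, div_le_one ht]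
  nlinarith [Real.sq_sqrt t.2.le, Real.sqrt_nonneg (t : ℝ), sq_nonneg (Real.sqrt t - 1)]

/-- The bounded continuous function `t ^ (1/2 + i s) / (1 + t)`. -/
def cpowDiv (s : ℝ) : BoundedContinuousFunction PosReal ℂ :=
  BoundedContinuousFunction.ofNormedAddCommGroup
    (fun t => cpow s t / (1 + (t : ℝ) : ℂ))
    ((continuous_cpow s).div (by fun_prop) fun t => by
      have ht : (0 : ℝ) < 1 + t := by have := t.2; linarith
      exact_mod_cast ht.ne') 1 (norm_cpow_div_le s)

/-- The character is unbounded, so weak convergence does not apply to it directly. It has the form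
`φ + t φ` with `φ` bounded and continuous, which is why the topology controls both `p[B × C]` and `t
• p[B × C]`. -/
lemma cpowDiv_add (s : ℝ) (t : PosReal) : cpowDiv s t + (t : ℝ) * cpowDiv s t = cpow s t := by
  have ht : (0 : ℝ) < 1 + t := by have := t.2; linarith
  have h1 : (1 + (t : ℝ) : ℂ) ≠ 0 := by exact_mod_cast ht.ne'
  change cpow s t / (1 + (t : ℝ) : ℂ) + (t : ℝ) * (cpow s t / (1 + (t : ℝ) : ℂ)) = _
  field_simp

end PosReal

lemma MeasureTheory.FiniteMeasure.continuous_integral_boundedContinuousFunction_complex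
    {X : Type*} [TopologicalSpace X] [MeasurableSpace X] [OpensMeasurableSpace X]
    (f : BoundedContinuousFunction X ℂ) :
    Continuous fun μ : FiniteMeasure X => ∫ t, f t ∂(μ : Measure X) :=
  continuous_iff_continuousAt.2 fun _ =>
    (FiniteMeasure.tendsto_iff_forall_integral_rclike_tendsto ℂ).1 Filter.tendsto_id f

namespace Polymorphism

variable {M N : LebesgueSpace.{u}}

lemma continuous_block {B : Set M} {C : Set N} (hB : MeasurableSet B) (hC : MeasurableSet C) :
    Continuous fun p : Polymorphism M N => p.block B C :=
  continuous_iff_le_induced.2 <| inf_le_of_left_le <| iInf_le_of_le B <| iInf_le_of_le hB <|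
    iInf_le_of_le C <| iInf_le_of_le hC le_rfl

lemma continuous_tBlock {B : Set M} {C : Set N} (hB : MeasurableSet B) (hC : MeasurableSet C) :
    Continuous fun p : Polymorphism M N => p.tBlock B C :=
  continuous_iff_le_induced.2 <| inf_le_of_right_le <| iInf_le_of_le B <| iInf_le_of_le hB <|
    iInf_le_of_le C <| iInf_le_of_le hC le_rfl

lemma integral_cpow_block (p : Polymorphism M N) (s : ℝ) (B : Set M) (C : Set N) :
    ∫ t, PosReal.cpow s t ∂(p.block B C : Measure PosReal) =
      ∫ t, PosReal.cpowDiv s t ∂(p.block B C : Measure PosReal) +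
      ∫ t, PosReal.cpowDiv s t ∂(p.tBlock B C : Measure PosReal) := by
  have h1 : Integrable (PosReal.cpowDiv s) (p.block B C : Measure PosReal) :=
    (PosReal.cpowDiv s).integrable _
  have h2 : ∀ t : PosReal, ((t : ℝ) : ℂ) * PosReal.cpowDiv s t =
      PosReal.cpow s t - PosReal.cpowDiv s t := fun t => by
    rw [← PosReal.cpowDiv_add s t, add_sub_cancel_left]
  have h3 : ∫ t, PosReal.cpowDiv s t ∂(p.tBlock B C : Measure PosReal) =
      ∫ t, ((t : ℝ) : ℂ) * PosReal.cpowDiv s t ∂(p.block B C : Measure PosReal) := by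
    change ∫ t, _ ∂((p.block B C : Measure PosReal).withDensity PosReal.toENNReal) = _
    rw [integral_withDensity_eq_integral_toReal_smul PosReal.measurable_toENNReal
      (Filter.Eventually.of_forall fun t => ENNReal.ofReal_lt_top)]
    refine integral_congr_ae (Filter.Eventually.of_forall fun t => ?_)
    have h4 : t.toENNReal.toReal = t := ENNReal.toReal_ofReal t.2.le
    simp only [h4, Complex.real_smul]
  rw [h3]
  simp only [h2]
  rw [integral_sub (p.integrable_cpow_block s B C) h1, add_sub_cancel]

/-- The bound is uniform in `p`; this lets continuity pass from indicators to all of `L²`. -/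
lemma norm_inner_operator_le (p : Polymorphism M N) (s : ℝ) (h : M.L2) (f : N.L2) :
    ‖inner ℂ h (p.operator s f)‖ ≤ ‖h‖ * ‖f‖ := by
  rw [operator, ContinuousLinearMap.comp_apply, ContinuousLinearMap.adjoint_inner_right]
  refine (norm_inner_le_norm _ _).trans_eq ?_
  simp

/-- The operator of a polymorphism depends on it continuously in the weak topology. -/
lemma continuous_inner_operator (s : ℝ) (h : M.L2) (f : N.L2) :
    Continuous fun p : Polymorphism M N => inner ℂ h (p.operator s f) := by
  -- Density is used in each argument separately, in `f` and, for `f` an indicator, in `h`. Limits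
  -- are covered by the uniform Lipschitz bound.
  refine L2_induction (fun f => Continuous fun p : Polymorphism M N =>
    inner ℂ h (p.operator s f)) (fun C hC => ?_) (fun c f hf => ?_) (fun f g hf hg => ?_)
    ?_ f
  · refine L2_induction (fun h => Continuous fun p : Polymorphism M N =>
      inner ℂ h (p.operator s (indicatorConstLp 2 hC (measure_ne_top N.measure C) (1 : ℂ))))
      (fun B hB => ?_) (fun c h hh => ?_) (fun g h hg hh => ?_) ?_ h
    · simp only [inner_operator_indicator, integral_cpow_block]
      exact ((FiniteMeasure.continuous_integral_boundedContinuousFunction_complex _).comp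
        (continuous_block hB hC)).add
        ((FiniteMeasure.continuous_integral_boundedContinuousFunction_complex _).comp
        (continuous_tBlock hB hC))
    · simp only [inner_smul_left]
      exact continuous_const.mul hh
    · simp only [inner_add_left]
      exact hg.add hh
    · refine isClosed_setOf_continuous_of_lipschitzWith
        (C := ‖indicatorConstLp 2 hC (measure_ne_top N.measure C) (1 : ℂ)‖₊) fun p =>
        LipschitzWith.of_dist_le_mul fun h h' => ?_
      rw [dist_eq_norm, dist_eq_norm, ← inner_sub_left, mul_comm]
      exact norm_inner_operator_le p s _ _
  · simp only [map_smul, inner_smul_right]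
    exact continuous_const.mul hf
  · simp only [map_add, inner_add_right]
    exact hf.add hg
  · refine isClosed_setOf_continuous_of_lipschitzWith (C := ‖h‖₊) fun p =>
        LipschitzWith.of_dist_le_mul fun f f' => ?_
    rw [dist_eq_norm, dist_eq_norm, ← inner_sub_right, ← map_sub]
    exact norm_inner_operator_le p s _ _

end Polymorphism

/-- Weakly continuous families of unitary operators are strongly continuous. -/
lemma continuous_unitary_apply_of_inner {X H : Type*} [TopologicalSpace X]
    [NormedAddCommGroup H] [InnerProductSpace ℂ H] [CompleteSpace H]
    (U : X → unitary (H →L[ℂ] H))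
    (hU : ∀ ξ η : H, Continuous fun x => inner ℂ ξ ((U x : H →L[ℂ] H) η)) (ξ : H) :
    Continuous fun x => (U x : H →L[ℂ] H) ξ := by
  refine continuous_iff_continuousAt.2 fun x₀ => ?_
  -- Since `U x` and `U x₀` preserve norms, the distance is governed by a single matrix element,
  -- which is continuous in `x`.
  have h1 : ∀ x, ‖(U x : H →L[ℂ] H) ξ - (U x₀ : H →L[ℂ] H) ξ‖ ^ 2 =
      2 * ‖ξ‖ ^ 2 - 2 * (inner ℂ ((U x₀ : H →L[ℂ] H) ξ) ((U x : H →L[ℂ] H) ξ)).re := by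
    intro x
    rw [← norm_neg, neg_sub, norm_sub_sq (𝕜 := ℂ),
      ContinuousLinearMap.norm_map_of_mem_unitary (U x).2,
      ContinuousLinearMap.norm_map_of_mem_unitary (U x₀).2]
    simp only [RCLike.re_eq_complex_re]
    ring
  have h2 : Continuous fun x => Real.sqrt
      (2 * ‖ξ‖ ^ 2 - 2 * (inner ℂ ((U x₀ : H →L[ℂ] H) ξ) ((U x : H →L[ℂ] H) ξ)).re) :=
    Real.continuous_sqrt.comp (continuous_const.sub
      (continuous_const.mul (Complex.continuous_re.comp (hU _ ξ))))
  rw [ContinuousAt, tendsto_iff_norm_sub_tendsto_zero]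
  have h3 := h2.tendsto x₀
  simp only [← h1, Real.sqrt_sq (norm_nonneg _), sub_self, norm_zero, ne_eq,
    OfNat.ofNat_ne_zero, not_false_eq_true, zero_pow, Real.sqrt_zero] at h3
  exact h3

/-- The unitary representation of `G` in `L²(M)` given by `f(m) ↦ f(mg) g'(m)^{1/2 + is}`. -/
def QuasiAction.unitaryRep {G : Type v} [Group G] [TopologicalSpace G] {M : LebesgueSpace.{u}}
    (S : QuasiAction G M) (hS : Continuous fun g => S.polymorphism g) (s : ℝ) :
    UnitaryRep G M.L2 where
  toHom := S.unitaryHom s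
  continuous_apply := continuous_unitary_apply_of_inner _ fun h f =>
    (Polymorphism.continuous_inner_operator s h f).comp hS

/-! ### Fixed vectors and quotients -/

namespace QuasiAction

variable {G : Type v} [Group G] {M : LebesgueSpace.{u}} (S : QuasiAction G M)

lemma polymorphism_of_measurePreserving {g : G}
    (hg : MeasurePreserving (S.act g) M.measure M.measure) :
    S.polymorphism g = Polymorphism.ofMap (S.act g) hg := by
  refine Polymorphism.ext_lintegral fun f hf => ?_
  rw [S.lintegral_polymorphism g hf, Polymorphism.lintegral_ofMap _ _ hf]
  refine lintegral_congr_ae ?_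
  filter_upwards [S.deriv_of_measurePreserving hg] with m hm
  rw [hm]

/-- The derivative is 1, so no twist by `s` remains: fixed vectors of measure preserving subgroups
are genuinely invariant functions, for every `s`. -/
lemma operator_of_measurePreserving {g : G}
    (hg : MeasurePreserving (S.act g) M.measure M.measure) (s : ℝ) (f : M.L2) :
    (S.polymorphism g).operator s f =ᵐ[M.measure] f ∘ S.act g := by
  rw [S.polymorphism_of_measurePreserving hg, Polymorphism.operator_ofMap]
  exact Lp.coeFn_compMeasurePreserving f hg

variable {S} {L : Subgroup G} (Q : S.InvariantQuotient L)

/-- The projection to the quotient is invariant. -/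
lemma InvariantQuotient.proj_act {g : G} (hg : g ∈ L) :
    Q.proj ∘ S.act g =ᵐ[M.measure] Q.proj := by
  -- The quotient is standard Borel, so countably many measurable sets separate its points and it
  -- suffices to compare preimages.
  refine Filter.EventuallyEq.of_forall_separating_preimage MeasurableSet fun C hC => ?_
  have hB := Q.measurePreserving.measurable hC
  exact (((Q.mem_iff _ hB).2 ⟨C, hC, Filter.EventuallyEq.rfl⟩).2 g hg)

lemma InvariantQuotient.measurable_of_fixed {f : M → ℂ} (hf : Measurable f)
    (hfix : ∀ g ∈ L, f ∘ S.act g =ᵐ[M.measure] f) : Measurable[S.invariantSigma L] f :=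
  fun _ hU => ⟨hf hU, fun g hg => (hfix g hg).preimage _⟩

/-- The square integrable functions invariant under `L` are lifted from the quotient. -/
lemma InvariantQuotient.mem_range_of_fixed (f : M.L2)
    (hfix : ∀ g ∈ L, f ∘ S.act g =ᵐ[M.measure] f) (s : ℝ) :
    f ∈ Set.range (Q.canonical.operator s) := by
  have hJ : ⇑(Q.canonical.operator s) = Lp.compMeasurePreservingₗᵢ ℂ Q.proj
      Q.measurePreserving := funext fun f => Polymorphism.operator_ofMap _ _ s f
  have hf : Measurable[S.invariantSigma L] f :=
    InvariantQuotient.measurable_of_fixed (Lp.stronglyMeasurable f).measurable hfix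
  -- An invariant function is measurable for the σ-algebra of invariant sets. Indicators of such
  -- sets descend by `Q.mem_iff`, and the range is closed under limits because the lift is an
  -- isometry.
  refine Lp.induction_stronglyMeasurable (S.invariantSigma_le L) (by norm_num)
    (fun f : M.L2 => f ∈ Set.range (Q.canonical.operator s)) (fun c B hB hμB => ?_)
    (fun f g hf hg _ _ _ h1 h2 => ?_) ?_ f
    ⟨f, hf.stronglyMeasurable, Filter.EventuallyEq.rfl⟩
  · obtain ⟨C, hC, hBC⟩ := (Q.mem_iff B hB.1).1 hB
    refine ⟨indicatorConstLp 2 hC (measure_ne_top _ _) c, ?_⟩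
    rw [Lp.simpleFunc.coe_indicatorConst, hJ]
    change Lp.compMeasurePreserving _ _ _ = _
    rw [Lp.indicatorConstLp_compMeasurePreserving]
    refine Lp.ext (indicatorConstLp_coeFn.trans
      (Filter.EventuallyEq.trans ?_ indicatorConstLp_coeFn.symm))
    exact indicator_ae_eq_of_ae_eq_set hBC.symm
  · obtain ⟨f', hf'⟩ := h1
    obtain ⟨g', hg'⟩ := h2
    exact ⟨f' + g', by rw [map_add, hf', hg']⟩
  · rw [hJ]
    let J : Q.space.L2 →ₗᵢ[ℂ] M.L2 := Lp.compMeasurePreservingₗᵢ ℂ Q.proj Q.measurePreserving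
    exact J.isometry.isClosedEmbedding.isClosed_range.preimage continuous_subtype_val

lemma InvariantQuotient.adjoint_operator_operator (s : ℝ) (f : Q.space.L2) :
    ContinuousLinearMap.adjoint (Q.canonical.operator s) (Q.canonical.operator s f) = f := by
  rw [← Polymorphism.operator_star, ← ContinuousLinearMap.comp_apply,
    ← Polymorphism.operator_comp, InvariantQuotient.canonical,
    Polymorphism.star_ofMap_comp_ofMap, Polymorphism.operator_id]
  rfl

/-- With `exists_of_mem_fixed`, identifies the range of the lift `J` with the fixed subspace. -/
lemma InvariantQuotient.operator_mem_fixed [TopologicalSpace G]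
    (hS : Continuous fun g => S.polymorphism g)
    (hL : ∀ g ∈ L, MeasurePreserving (S.act g) M.measure M.measure) (s : ℝ) (f : Q.space.L2) :
    Q.canonical.operator s f ∈ (S.unitaryRep hS s).fixed L := by
  intro g hg
  refine Lp.ext ((S.operator_of_measurePreserving (hL g hg) s _).trans ?_)
  have h1 : Q.canonical.operator s f =ᵐ[M.measure] f ∘ Q.proj := by
    rw [InvariantQuotient.canonical, Polymorphism.operator_ofMap]
    exact Lp.coeFn_compMeasurePreserving f _
  refine ((S.quasi g).ae_eq h1).trans (Filter.EventuallyEq.trans ?_ h1.symm)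
  exact (Q.proj_act hg).fun_comp f

lemma InvariantQuotient.exists_of_mem_fixed [TopologicalSpace G]
    (hS : Continuous fun g => S.polymorphism g)
    (hL : ∀ g ∈ L, MeasurePreserving (S.act g) M.measure M.measure) (s : ℝ) {f : M.L2}
    (hf : f ∈ (S.unitaryRep hS s).fixed L) : ∃ f', Q.canonical.operator s f' = f := by
  refine Q.mem_range_of_fixed f (fun g hg => ?_) s
  have h1 := S.operator_of_measurePreserving (hL g hg) s f
  rw [show (S.polymorphism g).operator s f = f from hf g hg] at h1
  exact h1.symm

/-- The range of `J` consists of fixed vectors, so `J*` vanishes on their orthogonal complement. -/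
lemma InvariantQuotient.adjoint_operator_projection [TopologicalSpace G]
    (hS : Continuous fun g => S.polymorphism g)
    (hL : ∀ g ∈ L, MeasurePreserving (S.act g) M.measure M.measure) (s : ℝ) (f : M.L2) :
    ContinuousLinearMap.adjoint (Q.canonical.operator s)
      (((S.unitaryRep hS s).fixed L).orthogonalProjectionOnto f : M.L2) =
    ContinuousLinearMap.adjoint (Q.canonical.operator s) f := by
  refine ext_inner_left ℂ fun h => ?_
  rw [ContinuousLinearMap.adjoint_inner_right, ContinuousLinearMap.adjoint_inner_right]
  exact Submodule.inner_orthogonalProjectionOnto_eq_of_mem_left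
    (⟨_, Q.operator_mem_fixed hS hL s h⟩ : (S.unitaryRep hS s).fixed L) f

/-- Writing `P f = J f'`, one has `J J* f = J J* P f = J J* J f' = J f' = P f`. -/
lemma InvariantQuotient.operator_adjoint_operator [TopologicalSpace G]
    (hS : Continuous fun g => S.polymorphism g)
    (hL : ∀ g ∈ L, MeasurePreserving (S.act g) M.measure M.measure) (s : ℝ) (f : M.L2) :
    Q.canonical.operator s (ContinuousLinearMap.adjoint (Q.canonical.operator s) f) =
      ((S.unitaryRep hS s).fixed L).orthogonalProjectionOnto f := by
  obtain ⟨f', hf'⟩ := Q.exists_of_mem_fixed hS hL s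
    (((S.unitaryRep hS s).fixed L).orthogonalProjectionOnto f).2
  rw [← Q.adjoint_operator_projection hS hL, ← hf', Q.adjoint_operator_operator]

end QuasiAction

/-! ### The polymorphisms `Ξ` and the functor on the train. -/

namespace GKAction

variable {G : Type v} [Group G] [TopologicalSpace G] {A : Type x} [PartialOrder A]
  {P : GKPair.{v, u, x} G A} {M : LebesgueSpace.{u}} (S : GKAction P M)

/-- The unitary representation of `G` in `L²(M)`. -/
def unitaryRep (s : ℝ) : UnitaryRep G M.L2 := S.toQuasiAction.unitaryRep S.continuous s

lemma measurePreserving_of_mem_sub {α : A} :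
    ∀ g ∈ P.sub α, MeasurePreserving (S.act g) M.measure M.measure :=
  fun g hg => S.preserving g (P.sub_le α hg)

variable {S}

/-- The lift of functions on the quotient to `K_α`-fixed vectors. -/
def liftFixed {α : A} (Q : S.Quotient α) (s : ℝ) (f : Q.space.L2) :
    (S.unitaryRep s).fixed (P.sub α) :=
  ⟨Q.canonical.operator s f, Q.operator_mem_fixed S.continuous S.measurePreserving_of_mem_sub s f⟩

/-- By functoriality the operator is `J_α* ρ_s(g) J_β`, and `J_α*` absorbs the projection contained
in `compress`. -/
lemma operator_Xi {α β : A} (Qα : S.Quotient α) (Qβ : S.Quotient β) (g : G) (s : ℝ)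
    (f : Qβ.space.L2) : (S.Xi Qα Qβ g).operator s f =
      ContinuousLinearMap.adjoint (Qα.canonical.operator s)
        ((S.unitaryRep s).compress (P.sub α) (P.sub β) g (liftFixed Qβ s f) : M.L2) := by
  have h1 := Qα.adjoint_operator_projection S.continuous S.measurePreserving_of_mem_sub s
    ((S.polymorphism g).operator s (Qβ.canonical.operator s f))
  rw [Xi, Polymorphism.operator_comp, Polymorphism.operator_star, Polymorphism.operator_comp]
  exact h1.symm

/-- The intertwining form, from `J_α J_α* = P(K_α)`; it lets compressed operators be chained in
`Xi_comp`. -/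
lemma liftFixed_operator_Xi {α β : A} (Qα : S.Quotient α) (Qβ : S.Quotient β) (g : G) (s : ℝ)
    (f : Qβ.space.L2) : liftFixed Qα s ((S.Xi Qα Qβ g).operator s f) =
      (S.unitaryRep s).compress (P.sub α) (P.sub β) g (liftFixed Qβ s f) := by
  have h1 := Qα.operator_adjoint_operator S.continuous S.measurePreserving_of_mem_sub s
    ((S.polymorphism g).operator s (Qβ.canonical.operator s f))
  refine Subtype.ext ?_
  change Qα.canonical.operator s ((S.Xi Qα Qβ g).operator s f) = _
  rw [Xi, Polymorphism.operator_comp, Polymorphism.operator_star, Polymorphism.operator_comp]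
  exact h1

/-- The train tests only separable Hilbert spaces in `Type u`; `M.L2` has to be one of them. -/
instance separableSpace_L2 : SeparableSpace M.L2 := by
  have : Fact ((2 : ℝ≥0∞) ≠ ⊤) := ⟨by norm_num⟩
  have : SecondCountableTopology M.L2 := Lp.SecondCountableTopology
  infer_instance

/-- `Ξ_{α,β}(g)` depends only on the class of `g`. -/
lemma Xi_eq_of_coset_eq {α β : A} (Qα : S.Quotient α) (Qβ : S.Quotient β) {g g' : G}
    (h : P.coset α β g = P.coset α β g') : S.Xi Qα Qβ g = S.Xi Qα Qβ g' := by
  rw [GKPair.coset_eq_iff] at h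
  refine Polymorphism.eq_of_operator_eq fun s => ContinuousLinearMap.ext fun f => ?_
  rw [operator_Xi, operator_Xi, h M.L2 (S.unitaryRep s)]

lemma Xi_one {α : A} (Q : S.Quotient α) : S.Xi Q Q 1 = 𝟙 Q.space := by
  rw [Xi, S.polymorphism_one, Polymorphism.id_comp, QuasiAction.InvariantQuotient.canonical,
    Polymorphism.star_ofMap_comp_ofMap]
  rfl

/-- Multiplicativity: `Ξ_{α,β}(g) Ξ_{β,γ}(h) = Ξ_{α,γ}(p)` if `[g] ∘ [h] = [p]`. -/
lemma Xi_comp {α β γ : A} (Qα : S.Quotient α) (Qβ : S.Quotient β) (Qγ : S.Quotient γ) {g h p : G}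
    (hp : P.cosetMul (P.coset α β g) (P.coset β γ h) = P.coset α γ p) :
    S.Xi Qα Qβ g ≫ S.Xi Qβ Qγ h = S.Xi Qα Qγ p := by
  rw [GKPair.coset_mul_eq_iff] at hp
  refine Polymorphism.eq_of_operator_eq fun s => ContinuousLinearMap.ext fun f => ?_
  change (Polymorphism.comp _ _).operator s f = _
  rw [Polymorphism.operator_comp, ContinuousLinearMap.comp_apply, operator_Xi,
    liftFixed_operator_Xi, operator_Xi, ← hp M.L2 (S.unitaryRep s)]
  rfl

/-- The functor from the train to the category of polymorphisms. -/
def trainFunctor (Q : ∀ α : A, S.Quotient α) : (Train P)ᵒᵖ ⥤ LebesgueSpace.{u} where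
  obj a := (Q a.unop.index).space
  map {a b} f := Quotient.lift (fun g => S.Xi (Q a.unop.index) (Q b.unop.index) g)
    (fun _ _ h => Xi_eq_of_coset_eq _ _ (Quotient.sound h)) f.unop
  map_id a := Xi_one _
  map_comp {a b c} f g := by
    obtain ⟨f', hf⟩ := P.exists_coset f.unop
    obtain ⟨g', hg⟩ := P.exists_coset g.unop
    obtain ⟨p, hp⟩ := P.exists_coset (P.cosetMul f.unop g.unop)
    -- Two reversals of order cancel, that of the opposite category and that in the composition of
    -- the train, leaving `cosetMul f.unop g.unop`.
    have hfg : (f ≫ g).unop = P.coset a.unop.index c.unop.index p := hp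
    rw [hf, hg] at hp
    rw [hfg, hf, hg]
    exact (Xi_comp _ _ _ hp).symm

end GKAction

end

theorem mainTheorem1 {G : Type v} [Group G] [TopologicalSpace G] [IsTopologicalGroup G]
    [SeparableSpace G] {A : Type x} [PartialOrder A] (P : GKPair.{v, u, x} G A)
    (M : LebesgueSpace.{u}) (S : GKAction P M) :
    (∀ α : A, Nonempty (S.Quotient α)) ∧
    ∀ Q : ∀ α : A, S.Quotient α,
      ∃ Ξ : (Train P)ᵒᵖ ⥤ LebesgueSpace.{u},
      ∃ obj_eq : ∀ α : A, Ξ.obj (Opposite.op ⟨α⟩) = (Q α).space,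
        ∀ (α β : A) (g : G),
          Ξ.map (Train.mor P α β g).op =
            eqToHom (obj_eq α) ≫ S.Xi (Q α) (Q β) g ≫ eqToHom (obj_eq β).symm := by
  refine ⟨fun α => S.nonempty_invariantQuotient (P.sub α), fun Q =>
    ⟨GKAction.trainFunctor Q, fun _ => rfl, fun α β g => ?_⟩⟩
  -- The object equalities hold by `rfl`, so both `eqToHom` are identities.
  exact ((Category.id_comp _).trans (Category.comp_id (S.Xi (Q α) (Q β) g))).symm
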